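/- **Skew Cauchy identity.** Let $n,m\ge 1$, let $\mathbf{x}_n=(x_1,\dots,x_n)$ and $\mathbf{y}_m=(y_1,\dots,y_m)$ be indeterminates, and let $\mathbf{a}=(a_k)_{k\in\mathbb{Z}}$, where for some $N\in\mathbb{Z}\sqcup\{\infty\}$ the $a_k$ with $k\le N$ are indeterminates and $a_k=0$ for $k>N$. Everything takes place in the ring of formal power series in these indeterminates over $\mathbb{Z}$ (or any commutative ring), infinite sums being coefficientwise. Partitions are drawn in English convention, and the content of the box $\mathsf{b}$ in row $i$ and column $j$ is $c(\mathsf{b})=j-i$. For partitions $\mu\subseteq\lambda$ the *factorial Schur polynomial* is $$s_{\lambda/\mu}(\mathbf{x}_n|\mathbf{a})=\sum_{T}\ \prod_{\mathsf{b}\in\lambda/\mu}\bigl(x_{T(\mathsf{b})}-a_{T(\mathsf{b})+c(\mathsf{b})}\bigr),$$ the sum being over the semistandard tableaux $T$ of shape $\lambda/\mu$ with entries in $\{1,\dots,n\}$; thus $s_{\lambda/\mu}(\mathbf{x}_n|{-\mathbf{a}})$ has the factors $x_{T(\mathsf{b})}+a_{T(\mathsf{b})+c(\mathsf{b})}$.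 An *edge labeled tableau* of shape $\lambda/\mu$ is a semistandard tableau of shape $\lambda/\mu$ with entries in $\{1,\dots,m\}$, together with a finite subset of $\{1,\dots,m\}$ on every horizontal edge that lies, in its column, between the bottom of $\mu$ and the bottom of $\lambda$ (both included; the columns to the right of $\lambda$ have just their edge on the top boundary of the first row), all but finitely many of these subsets being empty, such that every label on an edge is strictly greater than the entry in the box of $\lambda/\mu$ directly above the edge and strictly smaller than the entry in the box of $\lambda/\mu$ directly below it, whenever there is such a box. Labels on different edges are not compared. The *edge Schur function* is $$E^{\lambda/\mu}(\mathbf{y}_m|\mathbf{a})=\sum_{T}\ \prod_{\mathsf{b}\in\lambda/\mu}y_{T(\mathsf{b})}\ \prod_{e}\ \prod_{\ell\in A_e}y_\ell\,a_{c(e)},$$ the sum being over all edge labeled tableaux $T$ of shape $\lambda/\mu$, where $A_e$ is the set on the edge $e$ and $c(e)$ is the content of the position whose upper edge is $e$. If $\mu\not\subseteq\lambda$, both functions are $0$. For an integer $k\ge 0$ let $\mathbf{a}^{k}=(a^k_i)_{i\in\mathbb{Z}}$ with $a^{k}_i=a_{i+k+1}$. Then for all partitions $\mu$ and $\eta$ $$\sum_{\lambda}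 s_{\lambda/\mu}(\mathbf{x}_n|{-\mathbf{a}})\,E^{\lambda/\eta}(\mathbf{y}_m|\mathbf{a}^{n})=\prod_{\substack{1\le i\le n\\ 1\le j\le m}}\frac{1}{1-x_iy_j}\ \sum_{\kappa}s_{\eta/\kappa}(\mathbf{x}_n|{-\mathbf{a}})\,E^{\mu/\kappa}(\mathbf{y}_m|\mathbf{a}^{0}),$$ where the sums are over all partitions $\lambda$ and $\kappa$, and all the series involved converge. -/

import Mathlib

open scoped MvPowerSeries.WithPiTopology

noncomputable section

namespace SkewCauchy

/-- The boxes of the skew diagram `lam / mu`. As everywhere in Mathlib's `YoungDiagram`,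
a box is a pair (row, column) in English convention, counted from `0`. -/
abbrev SkewBox (lam mu : YoungDiagram) : Type := ↥(lam.cells \ mu.cells)

/-- The content (column minus row) of a position. -/
def content (b : ℕ × ℕ) : ℤ := (b.2 : ℤ) - (b.1 : ℤ)

/-- Semistandard fillings of `lam / mu` with `n` letters: rows weakly increase from left to
right and columns strictly increase from top to bottom. The element `k : Fin n` stands for
the letter `k + 1` of `{1, …, n}`. -/
def IsSemistandard {n : ℕ} {lam mu : YoungDiagram} (T : SkewBox lam mu → Fin n) : Prop :=
  (∀ b c : SkewBox lam mu, b.1.1 = c.1.1 → b.1.2 ≤ c.1.2 → T b ≤ T c) ∧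
  (∀ b c : SkewBox lam mu, b.1.2 = c.1.2 → b.1.1 < c.1.1 → T b < T c)

open Classical in
/-- The skew factorial Schur polynomial `s_{lam/mu}(x_1, …, x_n | a)`: the sum over the
semistandard tableaux `T` of shape `lam / mu` with letters in `{1, …, n}` of the product over
the boxes `b` of `x_{T(b)} - a_{T(b) + c(b)}`, and `0` if `mu` is not contained in `lam`. -/
def factorialSchur {A : Type*} [CommRing A] {n : ℕ} (lam mu : YoungDiagram)
    (x : Fin n → A) (a : ℤ → A) : A :=
  if mu ≤ lam then
    ∑ T : {T : SkewBox lam mu → Fin n // IsSemistandard T},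
      ∏ b : SkewBox lam mu, (x (T.1 b) - a (((T.1 b : ℕ) : ℤ) + 1 + content b.1))
  else 0

/-- A horizontal edge is named by the position whose upper edge it is. The edges of
`lam / mu` that may carry labels are the horizontal edges in each column from the bottom
of `mu` to the bottom of `lam`, both included; row `0` has a top boundary of infinite length,
so a column to the right of `lam` has just its edge on this boundary. -/
def IsLabelEdge (lam mu : YoungDiagram) (e : ℕ × ℕ) : Prop :=
  e ∉ mu ∧ ∀ i < e.1, (i, e.2) ∈ lam

/-- Edge labeled tableaux of shape `lam / mu` with entries and edge labels among `m` letters.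
The finite set `labels` of pairs `(e, l)` records that the letter `l` is in the set that labels
the edge `e`; so every edge has a finite set of labels, and it is empty for almost all edges. -/
structure EdgeTableau (m : ℕ) (lam mu : YoungDiagram) where
  /-- The entries in the boxes. -/
  entry : SkewBox lam mu → Fin m
  /-- The edge labels. -/
  labels : Finset ((ℕ × ℕ) × Fin m)
  semistandard : IsSemistandard entry
  isLabelEdge : ∀ p ∈ labels, IsLabelEdge lam mu p.1
  /-- A label is strictly smaller than the entry in the box below its edge. -/
  label_lt : ∀ p ∈ labels, ∀ b : SkewBox lam mu, b.1 = p.1 → p.2 < entry b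
  /-- A label is strictly greater than the entry in the box above its edge. -/
  lt_label : ∀ p ∈ labels, ∀ b : SkewBox lam mu, (b.1.1 + 1, b.1.2) = p.1 → entry b < p.2

/-- The weight of an edge labeled tableau: a factor `y_k` for every entry `k`, and a factor
`y_l a_{c(b)}` for every label `l` on the upper edge of the position `b`. -/
def EdgeTableau.weight {A : Type*} [CommRing A] {m : ℕ} {lam mu : YoungDiagram}
    (T : EdgeTableau m lam mu) (y : Fin m → A) (a : ℤ → A) : A :=
  (∏ b : SkewBox lam mu, y (T.entry b)) * ∏ p ∈ T.labels, (y p.2 * a (content p.1))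

open Classical in
/-- The edge Schur function `E^{lam/mu}(y_1, …, y_m | a)`, the generating series of the edge
labeled tableaux of shape `lam / mu`, and `0` if `mu` is not contained in `lam`. -/
def edgeSchur {A : Type*} [CommRing A] [TopologicalSpace A] {m : ℕ} (lam mu : YoungDiagram)
    (y : Fin m → A) (a : ℤ → A) : A :=
  if mu ≤ lam then ∑' T : EdgeTableau m lam mu, T.weight y a else 0

/-- The shifted parameters `a^n`, with `(a^n)_i = a_{i+n+1}`. -/
def shift {A : Type*} (n : ℕ) (a : ℤ → A) : ℤ → A := fun i => a (i + n + 1)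

/-- Formal power series in `x_1, …, x_n`, `y_1, …, y_m` and `a_k` for `k` in `ℤ`. With
`MvPowerSeries.WithPiTopology` it has the topology of coefficientwise convergence. -/
abbrev Series (n m : ℕ) (R : Type*) : Type _ := MvPowerSeries (Fin n ⊕ Fin m ⊕ ℤ) R

/-- The indeterminates `x_1, …, x_n`. -/
def varX (n m : ℕ) (R : Type*) [CommRing R] (i : Fin n) : Series n m R :=
  MvPowerSeries.X (Sum.inl i)

/-- The indeterminates `y_1, …, y_m`. -/
def varY (n m : ℕ) (R : Type*) [CommRing R] (j : Fin m) : Series n m R :=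
  MvPowerSeries.X (Sum.inr (Sum.inl j))

open Classical in
/-- The parameters `a`: indeterminates `a_k` for `k ≤ N`, and `a_k = 0` for `k > N`. For
`N = ⊤` all the `a_k` are indeterminates. -/
def paramA (n m : ℕ) (R : Type*) [CommRing R] (N : WithTop ℤ) (k : ℤ) : Series n m R :=
  if (k : WithTop ℤ) ≤ N then MvPowerSeries.X (Sum.inr (Sum.inr k)) else 0

end SkewCauchy

end

/-! The proof is a transfer matrix argument on matrices indexed by Young diagrams. A semistandard
tableau is a chain of horizontal strips, one per letter. Its weight is a product over the letters,
and so is the generating function of the admissible edge labels, so both functions are entries of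
products of one-letter matrices (`factorialSchur_neg_eq_chain`, `edgeSchur_eq_chain`). Letter `i` of
the Schur side uses the parameters `shift i a`, while all letters of the edge side use the same
parameters.

Write `U` and `V` for the one-letter Schur and edge matrices. The identity for one `x` and one `y`
(`skewCommute_schurStep_edgeStep`) says that moving `U` with parameters `b` past the transpose of
`V` produces the factor `1/(1 - xy)` and undoes one shift of the parameters of `V`. Moving all the
`U`s past all the `V`s collects the product of these factors and takes `shift n a` down to `shift 0
a`.

For one pair of variables, both sums run over diagrams whose rows interlace with those of `mu` and
`eta`: the row `i + 1` of the upper diagram and the row `i` of the lower one range over the same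
interval. Hence both sums factor over the rows. The factors agree by `sum_prod_Ico_exchange`,
because `(1 + y b) - y (x + b) = 1 - xy` does not depend on `b`. The upper diagram has one further
row, the unbounded first one; its sum telescopes and gives `1/(1 - xy)`
(`hasSum_geometric_edgeTail`). -/

noncomputable section

namespace SkewCauchy

/-! ### Families of power series with coefficientwise finite support -/

section Series

variable {σ R ι κ : Type*} [CommRing R]

/-- Only finitely many members of the family have a nonzero coefficient at any given
monomial. -/
def CoeffFinite (f : ι → MvPowerSeries σ R) : Prop :=
  ∀ d, {i | MvPowerSeries.coeff d (f i) ≠ 0}.Finite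

theorem exists_coeff_ne_zero_of_mul {f g : MvPowerSeries σ R} {d : σ →₀ ℕ}
    (h : MvPowerSeries.coeff d (f * g) ≠ 0) : ∃ e ≤ d, MvPowerSeries.coeff e g ≠ 0 := by
  classical
  rw [MvPowerSeries.coeff_mul] at h
  obtain ⟨p, hp, hne⟩ := Finset.exists_ne_zero_of_sum_ne_zero h
  exact ⟨p.2, Finset.HasAntidiagonal.mem_antidiagonal.1 hp ▸ le_add_self, right_ne_zero_of_mul hne⟩

theorem CoeffFinite.finite_exists_le {f : ι → MvPowerSeries σ R} (hf : CoeffFinite f)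
    (d : σ →₀ ℕ) : {i | ∃ e ≤ d, MvPowerSeries.coeff e (f i) ≠ 0}.Finite := by
  classical
  have h := (Set.finite_Iic d).biUnion fun e _ => hf e
  refine h.subset ?_
  rintro i ⟨e, he, hi⟩
  exact Set.mem_biUnion (Set.mem_Iic.2 he) hi

theorem CoeffFinite.summable [TopologicalSpace R] {f : ι → MvPowerSeries σ R}
    (hf : CoeffFinite f) : Summable f := by
  rw [MvPowerSeries.WithPiTopology.summable_iff_summable_coeff]
  exact fun d => summable_of_hasFiniteSupport (hf d)

theorem CoeffFinite.comp_injective {f : ι → MvPowerSeries σ R} (hf : CoeffFinite f)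
    {g : κ → ι} (hg : Function.Injective g) : CoeffFinite (fun i => f (g i)) :=
  fun d => (hf d).preimage hg.injOn

theorem CoeffFinite.mul_left {f : ι → MvPowerSeries σ R} (hf : CoeffFinite f)
    (g : ι → MvPowerSeries σ R) : CoeffFinite (fun i => g i * f i) :=
  fun d => (hf.finite_exists_le d).subset fun _ hi => exists_coeff_ne_zero_of_mul hi

/-- A monomial `d` of a product over `s` forces every factor to have a monomial dividing `d`. Only
finitely many `f i` do, so `s` is a subset of a fixed finite set. -/
theorem CoeffFinite.finset_prod {f : ι → MvPowerSeries σ R} (hf : CoeffFinite f) :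
    CoeffFinite (fun s : Finset ι => ∏ i ∈ s, f i) := by
  classical
  intro d
  have hfin := hf.finite_exists_le d
  refine (Finset.finite_toSet hfin.toFinset.powerset).subset fun s hs => ?_
  refine Finset.mem_coe.2 (Finset.mem_powerset.2 fun i hi => hfin.mem_toFinset.2 ?_)
  refine exists_coeff_ne_zero_of_mul (f := ∏ j ∈ s.erase i, f j) ?_
  rwa [Finset.prod_erase_mul _ _ hi]

theorem CoeffFinite.of_order {f : ι → MvPowerSeries σ R} {N : ι → ℕ}
    (hN : ∀ k, {i | f i ≠ 0 ∧ N i ≤ k}.Finite) (hf : ∀ i, (N i : ℕ∞) ≤ (f i).order) :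
    CoeffFinite f := by
  intro d
  refine (hN d.degree).subset fun i hi => ⟨?_, ?_⟩
  · intro h
    simp [h] at hi
  · exact_mod_cast (hf i).trans (MvPowerSeries.order_le hi)

/-- Regularity allows sums and products over pairs to be regrouped into iterated ones. -/
instance [TopologicalSpace R] [DiscreteTopology R] : T3Space (MvPowerSeries σ R) :=
  inferInstanceAs (T3Space ((σ →₀ ℕ) → R))

theorem CoeffFinite.multipliable_one_add [TopologicalSpace R]
    {f : ι → MvPowerSeries σ R} (hf : CoeffFinite f) : Multipliable (fun i => 1 + f i) :=
  multipliable_one_add_of_summable_prod hf.finset_prod.summable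

end Series

/-! ### Finiteness properties of Young diagrams -/

section Diagrams

theorem finite_setOf_le (lam : YoungDiagram) : {nu : YoungDiagram | nu ≤ lam}.Finite := by
  refine Set.Finite.of_finite_image (f := YoungDiagram.cells)
    ((Finset.finite_toSet lam.cells.powerset).subset ?_) ?_
  · rintro _ ⟨nu, h, rfl⟩
    simpa [YoungDiagram.cells_subset_iff] using h
  · intro a _ b _ h
    exact YoungDiagram.ext h

-- Provides `Finset.Iic lam`, which makes products of triangular matrices finite sums.
open Classical in
instance : LocallyFiniteOrderBot YoungDiagram :=
  LocallyFiniteOrderBot.ofIic YoungDiagram (fun lam => (finite_setOf_le lam).toFinset)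
    (by simp)

theorem card_mono {mu lam : YoungDiagram} (h : mu ≤ lam) : mu.card ≤ lam.card :=
  Finset.card_le_card (YoungDiagram.cells_subset_iff.2 h)

theorem fst_lt_card {lam : YoungDiagram} {b : ℕ × ℕ} (hb : b ∈ lam) : b.1 < lam.card := by
  have : (Finset.range (b.1 + 1)).card ≤ lam.cells.card :=
    Finset.card_le_card_of_injOn (fun i => (i, b.2))
      (fun i hi => lam.up_left_mem (Nat.lt_succ_iff.1 (Finset.mem_range.1 hi)) le_rfl hb)
      (fun i _ j _ h => congrArg Prod.fst h)
  simpa using this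

theorem snd_lt_card {lam : YoungDiagram} {b : ℕ × ℕ} (hb : b ∈ lam) : b.2 < lam.card := by
  have : (Finset.range (b.2 + 1)).card ≤ lam.cells.card :=
    Finset.card_le_card_of_injOn (fun j => (b.1, j))
      (fun j hj => lam.up_left_mem le_rfl (Nat.lt_succ_iff.1 (Finset.mem_range.1 hj)) hb)
      (fun i _ j _ h => congrArg Prod.snd h)
  simpa using this

theorem finite_setOf_card_le (k : ℕ) : {lam : YoungDiagram | lam.card ≤ k}.Finite := by
  refine Set.Finite.of_finite_image (f := YoungDiagram.cells)
    ((Finset.finite_toSet (Finset.range k ×ˢ Finset.range k).powerset).subset ?_) ?_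
  · rintro _ ⟨lam, h, rfl⟩
    simp only [Finset.coe_powerset, Set.mem_preimage, Set.mem_powerset_iff, Finset.coe_subset]
    intro b hb
    simp only [Finset.mem_product, Finset.mem_range]
    exact ⟨(fst_lt_card hb).trans_le h, (snd_lt_card hb).trans_le h⟩
  · intro a _ b _ h
    exact YoungDiagram.ext h

end Diagrams

/-! ### Triangular matrices and their commutation relations -/

/-- Matrices whose rows and columns are indexed by Young diagrams. -/
abbrev DiagramMatrix (A : Type*) : Type _ := YoungDiagram → YoungDiagram → A

namespace DiagramMatrix

/-- A matrix is triangular if its entry at `(mu, lam)` vanishes unless `mu ≤ lam`. -/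
def Triangular {A : Type*} [Zero A] (U : DiagramMatrix A) : Prop :=
  ∀ mu lam, ¬ mu ≤ lam → U mu lam = 0

open Classical in
/-- The identity matrix. -/
def id (A : Type*) [Zero A] [One A] : DiagramMatrix A := fun mu lam => if mu = lam then 1 else 0

/-- The product of two triangular matrices. -/
def comp {A : Type*} [CommRing A] (U V : DiagramMatrix A) : DiagramMatrix A :=
  fun mu lam => ∑ nu ∈ Finset.Iic lam, U mu nu * V nu lam

/-- The product of a finite sequence of triangular matrices. -/
def chain {A : Type*} [CommRing A] : {m : ℕ} → (Fin m → DiagramMatrix A) → DiagramMatrix A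
  | 0, _ => id A
  | m + 1, W => comp (chain fun i : Fin m => W i.castSucc) (W (Fin.last m))

section Triangular

variable {A : Type*} [CommRing A]

theorem triangular_id : Triangular (id A) := by
  intro mu lam h
  rw [id, if_neg]
  rintro rfl
  exact h le_rfl

theorem Triangular.comp {U : DiagramMatrix A} (hU : Triangular U) (V : DiagramMatrix A) :
    Triangular (comp U V) := by
  intro mu lam h
  refine Finset.sum_eq_zero fun nu hnu => ?_
  by_cases h' : mu ≤ nu
  · exact absurd (h'.trans (Finset.mem_Iic.1 hnu)) h
  · rw [hU _ _ h', zero_mul]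

theorem triangular_chain : ∀ {m : ℕ} {W : Fin m → DiagramMatrix A},
    (∀ i, Triangular (W i)) → Triangular (chain W)
  | 0, _, _ => triangular_id
  | _ + 1, _, h => (triangular_chain fun i => h i.castSucc).comp _

end Triangular

variable {σ R : Type*} [CommRing R]

/-- The entry at `(mu, lam)` has order at least `|lam| - |mu|`. -/
def Graded (V : DiagramMatrix (MvPowerSeries σ R)) : Prop :=
  ∀ mu lam, ((lam.card - mu.card : ℕ) : ℕ∞) ≤ (V mu lam).order

theorem graded_id : Graded (id (MvPowerSeries σ R)) := by
  intro mu lam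
  rw [id]
  split_ifs with h
  · simp [h]
  · simp

theorem le_order_sum {ι : Type*} (s : Finset ι) (f : ι → MvPowerSeries σ R) (k : ℕ∞)
    (h : ∀ i ∈ s, k ≤ (f i).order) : k ≤ (∑ i ∈ s, f i).order := by
  refine MvPowerSeries.le_order fun d hd => ?_
  rw [map_sum]
  exact Finset.sum_eq_zero fun i hi => MvPowerSeries.coeff_of_lt_order (hd.trans_le (h i hi))

theorem order_le_order_mul (f g : MvPowerSeries σ R) : g.order ≤ (f * g).order :=
  le_add_self.trans MvPowerSeries.le_order_mul

theorem le_order_mul_of_graded {V W : DiagramMatrix (MvPowerSeries σ R)} (hV : Graded V)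
    (hW : Graded W) (mu nu lam : YoungDiagram) :
    ((lam.card - mu.card : ℕ) : ℕ∞) ≤ (V mu nu * W nu lam).order := by
  refine le_trans ?_ ((add_le_add (hV mu nu) (hW nu lam)).trans MvPowerSeries.le_order_mul)
  norm_cast
  omega

theorem Graded.comp {V W : DiagramMatrix (MvPowerSeries σ R)} (hV : Graded V) (hW : Graded W) :
    Graded (comp V W) :=
  fun mu lam => le_order_sum _ _ _ fun nu _ => le_order_mul_of_graded hV hW mu nu lam

theorem graded_chain : ∀ {m : ℕ} {W : Fin m → DiagramMatrix (MvPowerSeries σ R)},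
    (∀ i, Graded (W i)) → Graded (chain W)
  | 0, _, _ => graded_id
  | _ + 1, _, h => (graded_chain fun i => h i.castSucc).comp (h _)

theorem coeffFinite_of_le_order {f : YoungDiagram → MvPowerSeries σ R} (k : ℕ)
    (hf : ∀ lam, ((lam.card - k : ℕ) : ℕ∞) ≤ (f lam).order) : CoeffFinite f := by
  refine CoeffFinite.of_order (N := fun lam => lam.card - k) (fun j => ?_) hf
  refine (finite_setOf_card_le (j + k)).subset fun lam h => ?_
  have := h.2
  simp only [Set.mem_ofPred_eq]
  omega

theorem Graded.coeffFinite_mul {V : DiagramMatrix (MvPowerSeries σ R)} (hV : Graded V)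
    (eta : YoungDiagram) (f : YoungDiagram → MvPowerSeries σ R) :
    CoeffFinite (fun lam => f lam * V eta lam) :=
  coeffFinite_of_le_order eta.card fun lam => (hV eta lam).trans (order_le_order_mul _ _)

theorem coeffFinite_of_le_order_of_ne_zero_imp_le
    {f : YoungDiagram × YoungDiagram → MvPowerSeries σ R} (k : ℕ)
    (hf : ∀ p, ((p.1.card - k : ℕ) : ℕ∞) ≤ (f p).order) (hle : ∀ p, f p ≠ 0 → p.2 ≤ p.1) :
    CoeffFinite f := by
  refine CoeffFinite.of_order (N := fun p => p.1.card - k) (fun j => ?_) hf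
  refine ((finite_setOf_card_le (j + k)).prod (finite_setOf_card_le (j + k))).subset ?_
  rintro p ⟨h0, h⟩
  have h1 := card_mono (hle p h0)
  simp only [Set.mem_prod, Set.mem_ofPred_eq]
  omega

variable [TopologicalSpace R]

/-- The relation `U Vᵀ = c V'ᵀ U`. -/
def SkewCommute (U V V' : DiagramMatrix (MvPowerSeries σ R)) (c : MvPowerSeries σ R) : Prop :=
  ∀ mu eta, HasSum (fun lam => U mu lam * V eta lam)
    (c * ∑ kap ∈ Finset.Iic eta, U kap eta * V' kap mu)

theorem skewCommute_id_left (V : DiagramMatrix (MvPowerSeries σ R)) :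
    SkewCommute (id _) V V 1 := by
  classical
  intro mu eta
  have h : (1 * ∑ kap ∈ Finset.Iic eta, id (MvPowerSeries σ R) kap eta * V kap mu)
      = id (MvPowerSeries σ R) mu mu * V eta mu := by
    rw [one_mul, Finset.sum_eq_single eta]
    · simp [id]
    · intro b _ hb
      simp [id, hb]
    · simp
  rw [h]
  refine hasSum_single (f := fun lam => id (MvPowerSeries σ R) mu lam * V eta lam) mu ?_
  intro b hb
  simp [id, hb.symm]

theorem skewCommute_id_right {U : DiagramMatrix (MvPowerSeries σ R)} (hU : Triangular U) :
    SkewCommute U (id _) (id _) 1 := by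
  classical
  intro mu eta
  have h : (1 * ∑ kap ∈ Finset.Iic eta, U kap eta * id (MvPowerSeries σ R) kap mu)
      = U mu eta * id (MvPowerSeries σ R) eta eta := by
    rw [one_mul, Finset.sum_eq_single mu]
    · simp [id]
    · intro b _ hb
      simp [id, hb]
    · intro h
      rw [hU _ _ (by simpa using h), zero_mul]
  rw [h]
  refine hasSum_single (f := fun lam => U mu lam * id (MvPowerSeries σ R) eta lam) eta ?_
  intro b hb
  simp [id, hb.symm]

variable [DiscreteTopology R]

/-- In matrix form: `U V₂ᵀ V₁ᵀ = c₂ V₂'ᵀ U V₁ᵀ = c₁ c₂ V₂'ᵀ V₁'ᵀ U`. The middle equality of infinite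
sums is obtained by summing the family `F` over pairs in both orders; the grading makes it summable.
-/
theorem SkewCommute.comp_right {U V₁ V₁' V₂ V₂' : DiagramMatrix (MvPowerSeries σ R)}
    {c₁ c₂ : MvPowerSeries σ R} (hU : Triangular U) (hV₂ : Triangular V₂) (hV₂' : Triangular V₂')
    (g₁ : Graded V₁) (g₂ : Graded V₂) (h₁ : SkewCommute U V₁ V₁' c₁)
    (h₂ : SkewCommute U V₂ V₂' c₂) :
    SkewCommute U (comp V₁ V₂) (comp V₁' V₂') (c₁ * c₂) := by
  intro mu eta
  let F : YoungDiagram × YoungDiagram → MvPowerSeries σ R := fun p =>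
    U mu p.1 * (V₁ eta p.2 * V₂ p.2 p.1)
  have hF : Summable F := by
    refine (coeffFinite_of_le_order_of_ne_zero_imp_le eta.card (fun p => ?_) fun p hp => ?_).summable
    · exact (le_order_mul_of_graded g₁ g₂ eta p.2 p.1).trans (order_le_order_mul _ _)
    · by_contra h
      exact hp (by simp [F, hV₂ _ _ h])
  have e₁ : HasSum (fun lam => U mu lam * comp V₁ V₂ eta lam) (∑' p, F p) := by
    refine hF.hasSum.prod_fiberwise fun lam => ?_
    rw [comp, Finset.mul_sum]
    refine hasSum_sum_of_ne_finset_zero fun nu hnu => ?_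
    simp [F, hV₂ _ _ (by simpa using hnu : ¬ nu ≤ lam)]
  have e₂ : HasSum (fun nu => V₁ eta nu * (c₂ * ∑ kap ∈ Finset.Iic nu, U kap nu * V₂' kap mu))
      (∑' p, F p) := by
    refine ((Equiv.prodComm _ _).hasSum_iff.2 hF.hasSum).prod_fiberwise fun nu => ?_
    refine ((h₂ mu nu).mul_left (V₁ eta nu)).congr_fun fun lam => ?_
    simp only [F, Function.comp, Equiv.prodComm_apply, Prod.swap]
    ring
  have e₃ : HasSum (fun nu => ∑ kap ∈ Finset.Iic mu, c₂ * V₂' kap mu * (U kap nu * V₁ eta nu))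
      (∑ kap ∈ Finset.Iic mu, c₂ * V₂' kap mu *
        (c₁ * ∑ tau ∈ Finset.Iic eta, U tau eta * V₁' tau kap)) :=
    hasSum_sum fun kap _ => (h₁ kap eta).mul_left _
  have e₄ : ∑' p, F p = ∑ kap ∈ Finset.Iic mu, c₂ * V₂' kap mu *
        (c₁ * ∑ tau ∈ Finset.Iic eta, U tau eta * V₁' tau kap) := by
    refine e₂.unique ?_
    convert e₃ using 2 with nu
    -- By triangularity only those `kap` contained in both `nu` and `mu` contribute. The range
    -- `Finset.Iic mu` is independent of `nu`, so the sums can be exchanged.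
    have : ∑ kap ∈ Finset.Iic nu, U kap nu * V₂' kap mu
        = ∑ kap ∈ Finset.Iic mu, U kap nu * V₂' kap mu := by
      rw [← finsum_eq_sum_of_support_subset, ← finsum_eq_sum_of_support_subset]
      · intro kap h
        by_contra h'
        exact h (by simp [hV₂' kap mu (by simpa using h')])
      · intro kap h
        by_contra h'
        exact h (by simp [hU kap nu (by simpa using h')])
    rw [this, Finset.mul_sum, Finset.mul_sum]
    exact Finset.sum_congr rfl fun _ _ => by ring
  rw [e₄] at e₁
  convert e₁ using 1
  simp only [comp, Finset.mul_sum]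
  rw [Finset.sum_comm]
  exact Finset.sum_congr rfl fun _ _ => Finset.sum_congr rfl fun _ _ => by ring

/-- In matrix form: `U₁ U₂ Vᵀ = c₂ U₁ V'ᵀ U₂ = c₁ c₂ V''ᵀ U₁ U₂`. -/
theorem SkewCommute.comp_left {U₁ U₂ V V' V'' : DiagramMatrix (MvPowerSeries σ R)}
    {c₁ c₂ : MvPowerSeries σ R} (hU₁ : Triangular U₁) (hU₂ : Triangular U₂)
    (g : Graded V) (h₁ : SkewCommute U₁ V' V'' c₁) (h₂ : SkewCommute U₂ V V' c₂) :
    SkewCommute (comp U₁ U₂) V V'' (c₁ * c₂) := by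
  intro mu eta
  let F : YoungDiagram × YoungDiagram → MvPowerSeries σ R := fun p =>
    U₁ mu p.2 * U₂ p.2 p.1 * V eta p.1
  have hF : Summable F := by
    refine (coeffFinite_of_le_order_of_ne_zero_imp_le eta.card (fun p => ?_) fun p hp => ?_).summable
    · exact (g eta p.1).trans (order_le_order_mul _ _)
    · by_contra h
      exact hp (by simp [F, hU₂ _ _ h])
  have e₁ : HasSum (fun lam => comp U₁ U₂ mu lam * V eta lam) (∑' p, F p) := by
    refine hF.hasSum.prod_fiberwise fun lam => ?_
    rw [comp, Finset.sum_mul]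
    refine hasSum_sum_of_ne_finset_zero fun nu hnu => ?_
    simp [F, hU₂ _ _ (by simpa using hnu : ¬ nu ≤ lam)]
  have e₂ : HasSum (fun nu => U₁ mu nu * (c₂ * ∑ kap ∈ Finset.Iic eta, U₂ kap eta * V' kap nu))
      (∑' p, F p) := by
    refine ((Equiv.prodComm _ _).hasSum_iff.2 hF.hasSum).prod_fiberwise fun nu => ?_
    refine ((h₂ nu eta).mul_left (U₁ mu nu)).congr_fun fun lam => ?_
    simp only [F, Function.comp, Equiv.prodComm_apply, Prod.swap]
    ring
  have e₃ : HasSum (fun nu => ∑ kap ∈ Finset.Iic eta, c₂ * U₂ kap eta * (U₁ mu nu * V' kap nu))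
      (∑ kap ∈ Finset.Iic eta, c₂ * U₂ kap eta *
        (c₁ * ∑ tau ∈ Finset.Iic kap, U₁ tau kap * V'' tau mu)) :=
    hasSum_sum fun kap _ => (h₁ mu kap).mul_left _
  have e₄ : ∑' p, F p = ∑ kap ∈ Finset.Iic eta, c₂ * U₂ kap eta *
        (c₁ * ∑ tau ∈ Finset.Iic eta, U₁ tau kap * V'' tau mu) := by
    have e₅ : ∀ kap ∈ Finset.Iic eta, ∑ tau ∈ Finset.Iic kap, U₁ tau kap * V'' tau mu
        = ∑ tau ∈ Finset.Iic eta, U₁ tau kap * V'' tau mu := by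
      intro kap hkap
      refine Finset.sum_subset (Finset.Iic_subset_Iic.2 (Finset.mem_Iic.1 hkap)) ?_
      intro tau _ h
      rw [hU₁ _ _ (by simpa using h), zero_mul]
    rw [Finset.sum_congr rfl fun kap hkap => by rw [← e₅ kap hkap]]
    refine e₂.unique ?_
    convert e₃ using 2 with nu
    rw [Finset.mul_sum, Finset.mul_sum]
    exact Finset.sum_congr rfl fun _ _ => by ring
  rw [e₄] at e₁
  convert e₁ using 1
  simp only [comp, Finset.mul_sum, Finset.sum_mul]
  rw [Finset.sum_comm]
  exact Finset.sum_congr rfl fun _ _ => Finset.sum_congr rfl fun _ _ => by ring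

theorem skewCommute_chain_right {U : DiagramMatrix (MvPowerSeries σ R)} (hU : Triangular U) :
    ∀ {m : ℕ} {V V' : Fin m → DiagramMatrix (MvPowerSeries σ R)} {c : Fin m → MvPowerSeries σ R},
    (∀ j, Triangular (V j)) → (∀ j, Triangular (V' j)) → (∀ j, Graded (V j)) →
    (∀ j, SkewCommute U (V j) (V' j) (c j)) → SkewCommute U (chain V) (chain V') (∏ j, c j)
  | 0, _, _, _, _, _, _, _ => by simpa [chain] using skewCommute_id_right hU
  | m + 1, V, V', c, h, h', g, hc => by
    rw [Fin.prod_univ_castSucc]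
    exact (skewCommute_chain_right hU (fun j => h j.castSucc) (fun j => h' j.castSucc)
      (fun j => g j.castSucc) fun j => hc j.castSucc).comp_right hU (h _) (h' _)
      (graded_chain fun j => g j.castSucc) (g _) (hc _)

/-- The index of `V` stands for the shift of the parameters: passing `U i` lowers it from `i + 1` to
`i`, so the last factor acts first. -/
theorem skewCommute_chain_left {V : ℕ → DiagramMatrix (MvPowerSeries σ R)}
    (g : ∀ k, Graded (V k)) :
    ∀ {n : ℕ} {U : Fin n → DiagramMatrix (MvPowerSeries σ R)} {c : Fin n → MvPowerSeries σ R},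
    (∀ i, Triangular (U i)) → (∀ i : Fin n, SkewCommute (U i) (V (i + 1)) (V i) (c i)) →
    SkewCommute (chain U) (V n) (V 0) (∏ i, c i)
  | 0, _, _, _, _ => by simpa [chain] using skewCommute_id_left (V 0)
  | n + 1, U, c, h, hc => by
    rw [Fin.prod_univ_castSucc]
    exact (skewCommute_chain_left g (fun i => h i.castSucc) fun i => hc i.castSucc).comp_left
      (triangular_chain fun i => h i.castSucc) (h _) (g _) (hc (Fin.last n))

end DiagramMatrix

/-! ### Horizontal strips and interlacing row lengths -/

section HorizontalStrips

/-- `lam / mu` is a horizontal strip: it has at most one box in every column. -/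
def HStrip (mu lam : YoungDiagram) : Prop :=
  mu ≤ lam ∧ ∀ i j, (i + 1, j) ∈ lam → (i, j) ∈ mu

theorem le_iff_rowLen {mu lam : YoungDiagram} :
    mu ≤ lam ↔ ∀ i, mu.rowLen i ≤ lam.rowLen i := by
  constructor
  · intro h i
    by_contra! hlt
    exact lt_irrefl _ (YoungDiagram.mem_iff_lt_rowLen.1 (h (YoungDiagram.mem_iff_lt_rowLen.2 hlt)))
  · rintro h ⟨i, j⟩ hb
    exact YoungDiagram.mem_iff_lt_rowLen.2 ((YoungDiagram.mem_iff_lt_rowLen.1 hb).trans_le (h i))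

theorem hStrip_iff_rowLen {mu lam : YoungDiagram} :
    HStrip mu lam ↔ ∀ i, mu.rowLen i ≤ lam.rowLen i ∧ lam.rowLen (i + 1) ≤ mu.rowLen i := by
  rw [HStrip, le_iff_rowLen, forall_and]
  refine and_congr_right fun _ => ⟨fun h i => ?_, fun h i j hb => ?_⟩
  · by_contra! hlt
    exact lt_irrefl _ (YoungDiagram.mem_iff_lt_rowLen.1
      (h i _ (YoungDiagram.mem_iff_lt_rowLen.2 hlt)))
  · exact YoungDiagram.mem_iff_lt_rowLen.2 ((YoungDiagram.mem_iff_lt_rowLen.1 hb).trans_le (h i))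

theorem eq_of_rowLen_eq {mu lam : YoungDiagram} (h : ∀ i, mu.rowLen i = lam.rowLen i) :
    mu = lam :=
  le_antisymm (le_iff_rowLen.2 fun i => (h i).le) (le_iff_rowLen.2 fun i => (h i).ge)

theorem rowLen_eq_zero_of_card_le {lam : YoungDiagram} {i : ℕ} (h : lam.card ≤ i) :
    lam.rowLen i = 0 := by
  by_contra h0
  have := fst_lt_card (YoungDiagram.mem_iff_lt_rowLen.2 (Nat.pos_of_ne_zero h0))
  dsimp only at this
  omega

/-- The Young diagram whose first `r` rows have the lengths `f 0 ≥ f 1 ≥ ⋯`. -/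
def ofRows (r : ℕ) (f : ℕ → ℕ) (hf : Antitone f) : YoungDiagram where
  cells := (Finset.range r ×ˢ Finset.range (f 0)).filter fun b => b.2 < f b.1
  isLowerSet := by
    rintro ⟨i, j⟩ ⟨i', j'⟩ ⟨hi, hj⟩ hb
    simp only [Finset.coe_filter, Finset.mem_product, Finset.mem_range, Set.mem_ofPred_eq] at *
    have := hf hi
    omega

theorem rowLen_ofRows (r : ℕ) (f : ℕ → ℕ) (hf : Antitone f) (i : ℕ) :
    (ofRows r f hf).rowLen i = if i < r then f i else 0 := by
  have key : ∀ j, j < (ofRows r f hf).rowLen i ↔ j < if i < r then f i else 0 := by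
    intro j
    rw [← YoungDiagram.mem_iff_lt_rowLen]
    have h0 := hf (Nat.zero_le i)
    change (i, j) ∈ (Finset.range r ×ˢ Finset.range (f 0)).filter _ ↔ _
    simp only [Finset.mem_filter, Finset.mem_product, Finset.mem_range]
    split_ifs <;> omega
  exact le_antisymm (le_of_forall_lt fun j hj => (key j).1 hj)
    (le_of_forall_lt fun j hj => (key j).2 hj)

theorem prod_sdiff_cells {A : Type*} [CommRing A] {mu lam : YoungDiagram} {r : ℕ}
    (hr : ∀ i, r ≤ i → lam.rowLen i = 0) (f : ℕ × ℕ → A) :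
    ∏ b ∈ lam.cells \ mu.cells, f b
      = ∏ i ∈ Finset.range r, ∏ j ∈ Finset.Ico (mu.rowLen i) (lam.rowLen i), f (i, j) := by
  rw [Finset.prod_sigma']
  refine Finset.prod_nbij' (fun b => ⟨b.1, b.2⟩) (fun b => (b.1, b.2)) ?_ ?_ ?_ ?_ ?_
  · rintro ⟨i, j⟩ hb
    simp only [Finset.mem_sdiff, YoungDiagram.mem_cells, YoungDiagram.mem_iff_lt_rowLen] at hb
    simp only [Finset.mem_sigma, Finset.mem_range, Finset.mem_Ico]
    refine ⟨?_, by omega⟩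
    by_contra! h
    have := hr i h
    omega
  · rintro ⟨i, j⟩ hb
    simp only [Finset.mem_sigma, Finset.mem_range, Finset.mem_Ico] at hb
    simp only [Finset.mem_sdiff, YoungDiagram.mem_cells, YoungDiagram.mem_iff_lt_rowLen]
    omega
  · intros; rfl
  · intros; rfl
  · intros; rfl

end HorizontalStrips

/-! ### One-letter transfer matrices -/

section Steps

open Classical in
/-- The contribution of one letter to a factorial Schur polynomial. -/
def schurStep {A : Type*} [CommRing A] (x : A) (a : ℤ → A) : DiagramMatrix A := fun mu lam =>
  if HStrip mu lam then ∏ b ∈ lam.cells \ mu.cells, (x + a (content b)) else 0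

open Classical in
/-- The contribution of one letter to an edge Schur function. If the letter is in the boxes of
`lam / mu`, it may label the edges below boxes of `mu` and above positions outside `lam`. -/
def edgeStep {A : Type*} [CommRing A] [TopologicalSpace A] (y : A) (a : ℤ → A) :
    DiagramMatrix A := fun mu lam =>
  if HStrip mu lam then
    (∏ _b ∈ lam.cells \ mu.cells, y) *
      ∏' e : {e : ℕ × ℕ | IsLabelEdge mu lam e}, (1 + y * a (content e))
  else 0

theorem triangular_schurStep {A : Type*} [CommRing A] (x : A) (a : ℤ → A) :
    (schurStep x a).Triangular :=
  fun _ _ h => if_neg fun h' => h h'.1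

theorem triangular_edgeStep {A : Type*} [CommRing A] [TopologicalSpace A] (y : A) (a : ℤ → A) :
    (edgeStep y a).Triangular :=
  fun _ _ h => if_neg fun h' => h h'.1

variable {σ R : Type*} [CommRing R]

theorem CoeffFinite.const_mul {ι : Type*} {a : ι → MvPowerSeries σ R} (ha : CoeffFinite a)
    (y : MvPowerSeries σ R) : CoeffFinite (fun k => y * a k) :=
  ha.mul_left fun _ => y

variable [TopologicalSpace R]

theorem graded_edgeStep {y : MvPowerSeries σ R} (hy : y.constantCoeff = 0)
    (a : ℤ → MvPowerSeries σ R) : (edgeStep y a).Graded := by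
  intro mu lam
  rw [edgeStep]
  split_ifs with h
  · rw [mul_comm, Finset.prod_const,
      Finset.card_sdiff_of_subset (YoungDiagram.cells_subset_iff.2 h.1)]
    exact (MvPowerSeries.le_order_pow_of_constantCoeff_eq_zero _ hy).trans
      (DiagramMatrix.order_le_order_mul _ _)
  · simp

theorem isLabelEdge_zero {mu lam : YoungDiagram} {j : ℕ} :
    IsLabelEdge mu lam (0, j) ↔ lam.rowLen 0 ≤ j := by
  simp [IsLabelEdge, YoungDiagram.mem_iff_lt_rowLen]

/-- The rows of `mu` get shorter downwards, so of the boxes above the edge only the nearest one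
matters. -/
theorem isLabelEdge_succ {mu lam : YoungDiagram} {i j : ℕ} :
    IsLabelEdge mu lam (i + 1, j) ↔ lam.rowLen (i + 1) ≤ j ∧ j < mu.rowLen i := by
  simp only [IsLabelEdge, YoungDiagram.mem_iff_lt_rowLen, not_lt]
  refine and_congr_right fun _ => ⟨fun h => h i (Nat.lt_succ_self i), fun h k hk => ?_⟩
  exact h.trans_le (mu.rowLen_anti _ _ (Nat.lt_succ_iff.1 hk))

/-- The product of the factors `1 + y a_k` over all `k ≥ t`. -/
def edgeTail (y : MvPowerSeries σ R) (a : ℤ → MvPowerSeries σ R) (t : ℤ) : MvPowerSeries σ R :=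
  ∏' j : ℕ, (1 + y * a (t + j))

theorem multipliable_edgeTail {a : ℤ → MvPowerSeries σ R} (ha : CoeffFinite a)
    (y : MvPowerSeries σ R) (t : ℤ) : Multipliable (fun j : ℕ => 1 + y * a (t + j)) :=
  ((ha.const_mul y).comp_injective (g := fun j : ℕ => t + j)
    (fun i j h => by simpa using h)).multipliable_one_add

variable [DiscreteTopology R]

theorem edgeTail_eq_mul {a : ℤ → MvPowerSeries σ R} (ha : CoeffFinite a)
    (y : MvPowerSeries σ R) (t : ℤ) :
    edgeTail y a t = (1 + y * a t) * edgeTail y a (t + 1) := by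
  have h1 := multipliable_edgeTail ha y (t + 1)
  have h2 : (fun j : ℕ => 1 + y * a (t + 1 + j)) = fun j : ℕ => 1 + y * a (t + (j + 1 : ℕ)) := by
    funext j
    push_cast
    ring_nf
  rw [edgeTail, edgeTail, h2]
  rw [h2] at h1
  have := tprod_eq_zero_mul' (f := fun j : ℕ => 1 + y * a (t + j)) h1
  simpa using this

theorem edgeTail_eq_prod_Ico_mul {a : ℤ → MvPowerSeries σ R} (ha : CoeffFinite a)
    (y : MvPowerSeries σ R) {s t : ℕ} (h : s ≤ t) :
    edgeTail y a s = (∏ j ∈ Finset.Ico s t, (1 + y * a j)) * edgeTail y a t := by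
  induction t, h using Nat.le_induction with
  | base => simp
  | succ t hst ih =>
    rw [ih, Finset.prod_Ico_succ_top hst, edgeTail_eq_mul ha y t]
    push_cast
    ring

/-- The only infinite part is the top boundary to the right of `lam`, the set `S`; the edges on
lower levels form the finite set `B`. -/
theorem tprod_isLabelEdge {a : ℤ → MvPowerSeries σ R} (ha : CoeffFinite a)
    (y : MvPowerSeries σ R) {mu lam : YoungDiagram} {r : ℕ}
    (hr : ∀ i, r ≤ i → mu.rowLen i = 0) :
    ∏' e : {e : ℕ × ℕ | IsLabelEdge mu lam e}, (1 + y * a (content e))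
      = edgeTail y a (lam.rowLen 0) * ∏ i ∈ Finset.range r,
          ∏ j ∈ Finset.Ico (lam.rowLen (i + 1)) (mu.rowLen i), (1 + y * a ((j : ℤ) - (i + 1))) := by
  classical
  let f : ℕ × ℕ → MvPowerSeries σ R := fun e => 1 + y * a (content e)
  let S : Set (ℕ × ℕ) := Set.range fun j : ℕ => (0, lam.rowLen 0 + j)
  let B : Finset (ℕ × ℕ) := (Finset.range r).biUnion fun i =>
    (Finset.Ico (lam.rowLen (i + 1)) (mu.rowLen i)).image fun j => (i + 1, j)
  have hS : HasProd (fun e : S => f e) (edgeTail y a (lam.rowLen 0)) := by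
    rw [Function.Injective.hasProd_range_iff (fun i j h => by simpa using h)]
    have h := (multipliable_edgeTail ha y (lam.rowLen 0)).hasProd
    refine h.congr_fun fun j => ?_
    simp [f, content]
  have hB : HasProd (fun e : (B : Set (ℕ × ℕ)) => f e) (∏ i ∈ Finset.range r,
      ∏ j ∈ Finset.Ico (lam.rowLen (i + 1)) (mu.rowLen i), (1 + y * a ((j : ℤ) - (i + 1)))) := by
    suffices h : ∏ e ∈ B, f e = ∏ i ∈ Finset.range r, ∏ j ∈
        Finset.Ico (lam.rowLen (i + 1)) (mu.rowLen i), (1 + y * a ((j : ℤ) - (i + 1))) by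
      rw [← h]
      exact B.hasProd f
    rw [Finset.prod_biUnion]
    · refine Finset.prod_congr rfl fun i _ => ?_
      rw [Finset.prod_image (fun j _ k _ h => by simpa using h)]
      simp [f, content]
    · intro i _ k _ hik
      rw [Function.onFun, Finset.disjoint_left]
      intro b hb hb'
      simp only [Finset.mem_image] at hb hb'
      obtain ⟨j, _, rfl⟩ := hb
      obtain ⟨j', _, h⟩ := hb'
      simp only [Prod.mk.injEq] at h
      omega
  have hd : Disjoint S (B : Set (ℕ × ℕ)) := by
    rw [Set.disjoint_left]
    rintro _ ⟨j, rfl⟩ hb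
    simp [B] at hb
  have hset : {e : ℕ × ℕ | IsLabelEdge mu lam e} = S ∪ (B : Set (ℕ × ℕ)) := by
    ext ⟨i, j⟩
    rcases i with _ | i
    · rw [Set.mem_ofPred_eq, isLabelEdge_zero]
      simp only [S, B, Set.mem_union, Set.mem_range, Prod.mk.injEq, true_and, Finset.mem_coe,
        Finset.mem_biUnion, Finset.mem_image, Nat.add_eq_zero_iff, one_ne_zero, and_false,
        false_and, exists_false, or_false]
      exact ⟨fun h => ⟨j - lam.rowLen 0, by omega⟩, by rintro ⟨k, rfl⟩; omega⟩
    · rw [Set.mem_ofPred_eq, isLabelEdge_succ]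
      simp only [S, B, Set.mem_union, Set.mem_range, Prod.mk.injEq, Finset.mem_coe,
        Finset.mem_biUnion, Finset.mem_image, Finset.mem_range, Finset.mem_Ico]
      constructor
      · intro h
        refine Or.inr ⟨i, ?_, j, h, rfl, rfl⟩
        by_contra! hi
        have := hr i hi
        omega
      · rintro (⟨k, hk, _⟩ | ⟨k, _, l, hl, hk, rfl⟩)
        · omega
        · obtain rfl : k = i := by omega
          exact hl
  have h := HasProd.mul_disjoint (f := f) hd hS hB
  rw [← hset] at h
  exact h.tprod_eq

end Steps

/-! ### Products over intervals and the exchange identity -/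

section Intervals

variable {A : Type*} [CommRing A]

/-- Splits off a factor that does not involve `s`. It is an empty product if `q ≤ p`, so later
computations need no case distinction on which of two rows is longer. -/
theorem prod_Ico_of_max_le (f : ℕ → A) {p q s : ℕ} (h : max p q ≤ s) :
    ∏ j ∈ Finset.Ico p s, f j
      = (∏ j ∈ Finset.Ico p q, f j) * ∏ j ∈ Finset.Ico (max p q) s, f j := by
  rcases le_total p q with hpq | hpq
  · rw [max_eq_right hpq] at *
    rw [Finset.prod_Ico_consecutive _ hpq h]
  · rw [max_eq_left hpq, Finset.Ico_eq_empty_of_le hpq, Finset.prod_empty, one_mul]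

theorem prod_Ico_of_le_min (f : ℕ → A) {p q s : ℕ} (h : s ≤ min p q) :
    ∏ j ∈ Finset.Ico s q, f j
      = (∏ j ∈ Finset.Ico p q, f j) * ∏ j ∈ Finset.Ico s (min p q), f j := by
  rcases le_total p q with hpq | hpq
  · rw [min_eq_left hpq] at *
    rw [mul_comm, Finset.prod_Ico_consecutive _ h hpq]
  · rw [min_eq_right hpq, Finset.Ico_eq_empty_of_le hpq, Finset.prod_empty, one_mul]

theorem sum_prod_Ico_succ (P Q : ℕ → A) {lo hi : ℕ} (h : lo ≤ hi) :
    ∑ t ∈ Finset.Icc lo (hi + 1),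
        (∏ j ∈ Finset.Ico lo t, P j) * ∏ j ∈ Finset.Ico t (hi + 1), Q (j + 1)
      = (∑ t ∈ Finset.Icc lo hi,
          (∏ j ∈ Finset.Ico lo t, P j) * ∏ j ∈ Finset.Ico t hi, Q (j + 1)) * Q (hi + 1)
        + ∏ j ∈ Finset.Ico lo (hi + 1), P j := by
  rw [Finset.sum_Icc_succ_top (by omega), Finset.sum_mul]
  congr 1
  · refine Finset.sum_congr rfl fun t ht => ?_
    rw [Finset.prod_Ico_succ_top (Finset.mem_Icc.1 ht).2, mul_assoc]
  · simp

/-- Substituting `c = Q t - P t` in the summand `t` makes the sum telescope through the mixed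
products with `P` before some position and `Q` from there on. -/
theorem mul_sum_prod_Ico (P Q : ℕ → A) (c : A) (hc : ∀ j, Q j = P j + c) {lo hi : ℕ}
    (h : lo ≤ hi) :
    c * ∑ t ∈ Finset.Icc lo hi, (∏ j ∈ Finset.Ico lo t, P j) * ∏ j ∈ Finset.Ico t hi, Q (j + 1)
      = (∏ j ∈ Finset.Ico lo (hi + 1), Q j) - ∏ j ∈ Finset.Ico lo (hi + 1), P j := by
  induction hi, h using Nat.le_induction with
  | base => simp [hc]
  | succ t ht ih =>
    rw [sum_prod_Ico_succ P Q ht, Finset.prod_Ico_succ_top (by omega : lo ≤ t + 1) Q,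
      Finset.prod_Ico_succ_top (by omega : lo ≤ t + 1) P]
    linear_combination Q (t + 1) * ih - (∏ j ∈ Finset.Ico lo (t + 1), P j) * hc (t + 1)

/-- If `Q - P` is constant, then `P` and `Q` may be exchanged in this sum. -/
theorem sum_prod_Ico_exchange (P Q : ℕ → A) (c : A) (hc : ∀ j, Q j = P j + c) (lo hi : ℕ) :
    ∑ t ∈ Finset.Icc lo hi, (∏ j ∈ Finset.Ico lo t, P j) * ∏ j ∈ Finset.Ico t hi, Q (j + 1)
      = ∑ t ∈ Finset.Icc lo hi,
          (∏ j ∈ Finset.Ico lo t, Q j) * ∏ j ∈ Finset.Ico t hi, P (j + 1) := by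
  rcases lt_or_ge hi lo with h | h
  · simp [Finset.Icc_eq_empty_of_lt h]
  · induction hi, h using Nat.le_induction with
    | base => simp
    | succ t ht ih =>
      rw [sum_prod_Ico_succ P Q ht, sum_prod_Ico_succ Q P ht, ← ih]
      -- With the two sums up to `t` identified, the two recursions differ by `c` times this sum and
      -- by the difference of the full products of `Q` and `P`. These cancel, and no division by `c`
      -- is needed.
      linear_combination mul_sum_prod_Ico P Q c hc ht +
        (∑ t_1 ∈ Finset.Icc lo t, (∏ j ∈ Finset.Ico lo t_1, P j) *
          ∏ j ∈ Finset.Ico t_1 t, Q (j + 1)) * hc (t + 1)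

end Intervals

/-! ### The sum over the length of a single row -/

section Rows

variable {A : Type*} [CommRing A]

/-- The weight of the boxes of row `i` in the columns from `p` to `q - 1`. -/
def rowSchur (x : A) (b : ℤ → A) (i p q : ℕ) : A := ∏ j ∈ Finset.Ico p q, (x + b ((j : ℤ) - i))

/-- The weight of the upper edges of row `i` in the columns from `p` to `q - 1`. -/
def rowEdge (y : A) (b : ℤ → A) (i p q : ℕ) : A := ∏ j ∈ Finset.Ico p q, (1 + y * b ((j : ℤ) - i))

/-- The sum over the lengths of one row, without its boundary factors. -/
def rowCore (x y : A) (b : ℤ → A) (i lo hi : ℕ) : A :=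
  ∑ t ∈ Finset.Icc lo hi, (∏ j ∈ Finset.Ico lo t, y * (x + b ((j : ℤ) - (i + 1 : ℕ)))) *
    ∏ j ∈ Finset.Ico t hi, (1 + y * b ((j : ℤ) - i))

/-- Going from row `i + 1` to row `i` raises contents by one, which is the shift `j + 1` in
`sum_prod_Ico_exchange`; the constant there is `1 - x * y`. -/
theorem rowCore_eq (x y : A) (b : ℤ → A) (i lo hi : ℕ) :
    rowCore x y b i lo hi =
      ∑ t ∈ Finset.Icc lo hi, (∏ j ∈ Finset.Ico lo t, (1 + y * b ((j : ℤ) - (i + 1 : ℕ)))) *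
        ∏ j ∈ Finset.Ico t hi, y * (x + b ((j : ℤ) - i)) := by
  have h := sum_prod_Ico_exchange (fun j => y * (x + b ((j : ℤ) - (i + 1 : ℕ))))
    (fun j => 1 + y * b ((j : ℤ) - (i + 1 : ℕ))) (1 - x * y) (fun j => by ring) lo hi
  simpa [rowCore, add_sub_add_right_eq_sub] using h

theorem prod_Ico_const_mul (f : ℕ → A) (y : A) (p q : ℕ) :
    ∏ j ∈ Finset.Ico p q, y * f j = y ^ (q - p) * ∏ j ∈ Finset.Ico p q, f j := by
  rw [Finset.prod_mul_distrib, Finset.prod_const, Nat.card_Ico]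

/-- The lengths `p, q` are those of row `i`, and `p', q'` those of row `i + 1`. -/
theorem sum_row_upper (x y : A) (b : ℤ → A) (i p q p' q' : ℕ) :
    ∑ s ∈ Finset.Icc (max p' q') (min p q),
        rowSchur x b (i + 1) p' s * y ^ (s - q') * rowEdge y b i s q
      = rowSchur x b (i + 1) p' q' * y ^ (p' - q') * rowEdge y b i p q *
          rowCore x y b i (max p' q') (min p q) := by
  rw [rowCore, Finset.mul_sum]
  refine Finset.sum_congr rfl fun s hs => ?_
  obtain ⟨h1, h2⟩ := Finset.mem_Icc.1 hs
  rw [rowSchur, prod_Ico_of_max_le _ h1, rowEdge, prod_Ico_of_le_min _ h2, prod_Ico_const_mul,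
    -- Truncated subtraction: `p' - q'` is zero if `p' ≤ q'`, matching the empty interval in the
    -- other factor.
    show s - q' = (p' - q') + (s - max p' q') by omega, pow_add, rowSchur, rowEdge]
  ring

theorem sum_row_lower (x y : A) (b : ℤ → A) (i p q p' q' : ℕ) :
    ∑ s ∈ Finset.Icc (max p' q') (min p q),
        rowSchur x b i s q * y ^ (p - s) * rowEdge y b (i + 1) p' s
      = rowSchur x b i p q * y ^ (p - q) * rowEdge y b (i + 1) p' q' *
          rowCore x y b i (max p' q') (min p q) := by
  rw [rowCore_eq, Finset.mul_sum]
  refine Finset.sum_congr rfl fun s hs => ?_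
  obtain ⟨h1, h2⟩ := Finset.mem_Icc.1 hs
  rw [rowSchur, prod_Ico_of_le_min _ h2, rowEdge, prod_Ico_of_max_le _ h1, prod_Ico_const_mul,
    show p - s = (p - q) + (min p q - s) by omega, pow_add, rowSchur, rowEdge]
  ring

theorem rowSchur_self (x : A) (b : ℤ → A) (i p : ℕ) : rowSchur x b i p p = 1 := by
  simp [rowSchur]

theorem rowEdge_self (y : A) (b : ℤ → A) (i p : ℕ) : rowEdge y b i p p = 1 := by
  simp [rowEdge]

end Rows

/-! ### The sum over the unbounded first row -/

section FirstRow

variable {σ R : Type*} [CommRing R] [TopologicalSpace R] [DiscreteTopology R]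

/-- Since `1 - x y = (1 + y b j) - y (x + b j)`, multiplying a term by `1 - x y` gives a difference
of consecutive terms of `G`, which tends to zero because its terms contain growing powers of `y`. -/
theorem hasSum_geometric_edgeTail {b : ℤ → MvPowerSeries σ R} (hb : CoeffFinite b)
    (x : MvPowerSeries σ R) {y : MvPowerSeries σ R} (hy : y.constantCoeff = 0) (s : ℕ) :
    HasSum (fun k : ℕ => (∏ j ∈ Finset.Ico s (s + k), y * (x + b j)) * edgeTail y b (s + k + 1 : ℕ))
      (MvPowerSeries.invOfUnit (1 - x * y) 1 * edgeTail y b s) := by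
  have hfin : ∀ g : ℕ → MvPowerSeries σ R,
      Summable fun k : ℕ => (∏ j ∈ Finset.Ico s (s + k), y * (x + b j)) * g k := by
    intro g
    refine (CoeffFinite.of_order (N := fun k => k) (fun k => ?_) fun k => ?_).summable
    · exact (Set.finite_Iic k).subset fun i hi => hi.2
    · rw [mul_comm, prod_Ico_const_mul, mul_comm (y ^ _), Nat.add_sub_cancel_left]
      exact ((MvPowerSeries.le_order_pow_of_constantCoeff_eq_zero _ hy).trans
        (DiagramMatrix.order_le_order_mul _ _)).trans (DiagramMatrix.order_le_order_mul _ _)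
  set G : ℕ → MvPowerSeries σ R := fun k =>
    (∏ j ∈ Finset.Ico s (s + k), y * (x + b j)) * edgeTail y b (s + k : ℕ)
  set F : ℕ → MvPowerSeries σ R := fun k =>
    (∏ j ∈ Finset.Ico s (s + k), y * (x + b j)) * edgeTail y b (s + k + 1 : ℕ)
  have hG : Summable G := hfin _
  have hF : Summable F := hfin _
  have hG' : Summable fun k => G (k + 1) := (summable_nat_add_iff 1).2 hG
  have hFG : ∀ k, (1 - x * y) * F k = G k - G (k + 1) := by
    intro k
    simp only [F, G]
    rw [← add_assoc, Finset.prod_Ico_succ_top (by omega),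
      edgeTail_eq_mul hb y (s + k : ℕ)]
    push_cast
    ring
  have hsum : (1 - x * y) * ∑' k, F k = edgeTail y b s := by
    rw [← hF.tsum_mul_left, tsum_congr hFG, hG.tsum_sub hG', hG.tsum_eq_zero_add]
    simp [G]
  have hinv : MvPowerSeries.invOfUnit (1 - x * y) 1 * (1 - x * y) = 1 :=
    MvPowerSeries.invOfUnit_mul _ _ (by simp [hy])
  have : MvPowerSeries.invOfUnit (1 - x * y) 1 * edgeTail y b s = ∑' k, F k := by
    rw [← hsum, ← mul_assoc, hinv, one_mul]
  rw [this]
  exact hF.hasSum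

end FirstRow

/-! ### Parametrization of the diagrams between or around `mu` and `eta` -/

section Interlacing

/-- The function on `ℕ` that extends `p` by zero. -/
def extendZero {r : ℕ} (p : Fin r → ℕ) (i : ℕ) : ℕ := if h : i < r then p ⟨i, h⟩ else 0

/-- The sequences of length `r` that interlace with the rows of both diagrams. -/
def interlacing (mu eta : YoungDiagram) (r : ℕ) : Finset (Fin r → ℕ) :=
  Fintype.piFinset fun i => Finset.Icc (max (mu.rowLen (i + 1)) (eta.rowLen (i + 1)))
    (min (mu.rowLen i) (eta.rowLen i))

variable {mu eta : YoungDiagram} {r : ℕ}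

theorem extendZero_bounds {p : Fin r → ℕ} (hp : p ∈ interlacing mu eta r) {i : ℕ} (hi : i < r) :
    mu.rowLen (i + 1) ≤ extendZero p i ∧ eta.rowLen (i + 1) ≤ extendZero p i ∧
      extendZero p i ≤ mu.rowLen i ∧ extendZero p i ≤ eta.rowLen i := by
  have := Fintype.mem_piFinset.1 hp ⟨i, hi⟩
  simp only [Finset.mem_Icc, max_le_iff, le_min_iff] at this
  rw [extendZero, dif_pos hi]
  tauto

theorem extendZero_of_le {p : Fin r → ℕ} {i : ℕ} (hi : r ≤ i) : extendZero p i = 0 :=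
  dif_neg (by omega)

theorem antitone_extendZero {p : Fin r → ℕ} (hp : p ∈ interlacing mu eta r) :
    Antitone (extendZero p) := by
  refine antitone_nat_of_succ_le fun i => ?_
  rcases lt_or_ge (i + 1) r with h | h
  · have h1 := extendZero_bounds hp h
    have h2 := extendZero_bounds hp (by omega : i < r)
    omega
  · rw [extendZero_of_le h]
    omega

/-- The sequence `p` preceded by `t`. -/
def consRow (t : ℕ) (p : Fin r → ℕ) : ℕ → ℕ
  | 0 => t
  | i + 1 => extendZero p i

theorem antitone_consRow {p : Fin r → ℕ} (hp : p ∈ interlacing mu eta r) {t : ℕ}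
    (ht : mu.rowLen 0 ≤ t) : Antitone (consRow t p) := by
  refine antitone_nat_of_succ_le fun i => ?_
  rcases i with _ | i
  · change extendZero p 0 ≤ t
    rcases Nat.eq_zero_or_pos r with rfl | h
    · rw [extendZero_of_le le_rfl]
      omega
    · have := extendZero_bounds hp h
      omega
  · exact antitone_extendZero hp (Nat.le_succ i)

/-- The diagram with the rows `p`. -/
def lowerDiagram (p : interlacing mu eta r) : YoungDiagram :=
  ofRows r (extendZero p.1) (antitone_extendZero p.2)

/-- The diagram with the rows `p` below a first row which is `k` boxes longer than the first
rows of `mu` and `eta`. -/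
def upperDiagram (q : ℕ × interlacing mu eta r) : YoungDiagram :=
  ofRows (r + 1) (consRow (max (mu.rowLen 0) (eta.rowLen 0) + q.1) q.2.1)
    (antitone_consRow q.2.2 (by omega))

theorem rowLen_lowerDiagram (p : interlacing mu eta r) (i : ℕ) :
    (lowerDiagram p).rowLen i = extendZero p.1 i := by
  rw [lowerDiagram, rowLen_ofRows]
  split_ifs with h
  · rfl
  · rw [extendZero_of_le (by omega)]

theorem rowLen_upperDiagram_zero (q : ℕ × interlacing mu eta r) :
    (upperDiagram q).rowLen 0 = max (mu.rowLen 0) (eta.rowLen 0) + q.1 := by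
  rw [upperDiagram, rowLen_ofRows, if_pos (by omega), consRow]

theorem rowLen_upperDiagram_succ (q : ℕ × interlacing mu eta r) (i : ℕ) :
    (upperDiagram q).rowLen (i + 1) = extendZero q.2.1 i := by
  rw [upperDiagram, rowLen_ofRows, consRow]
  split_ifs with h
  · rfl
  · rw [extendZero_of_le (by omega)]

theorem extendZero_injective : Function.Injective (extendZero (r := r)) := by
  intro p q h
  funext i
  simpa [extendZero] using congrFun h i

theorem lowerDiagram_injective :
    Function.Injective (lowerDiagram (mu := mu) (eta := eta) (r := r)) := by
  intro p q h
  refine Subtype.ext (extendZero_injective (funext fun i => ?_))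
  rw [← rowLen_lowerDiagram, ← rowLen_lowerDiagram, h]

theorem upperDiagram_injective :
    Function.Injective (upperDiagram (mu := mu) (eta := eta) (r := r)) := by
  intro p q h
  refine Prod.ext ?_ (Subtype.ext (extendZero_injective (funext fun i => ?_)))
  · have h1 := rowLen_upperDiagram_zero p
    rw [h, rowLen_upperDiagram_zero] at h1
    omega
  · rw [← rowLen_upperDiagram_succ, ← rowLen_upperDiagram_succ, h]

theorem hStrip_lowerDiagram
    (hmu : ∀ i, r ≤ i → mu.rowLen i = 0)
    (heta : ∀ i, r ≤ i → eta.rowLen i = 0)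
    (p : interlacing mu eta r) :
    HStrip (lowerDiagram p) mu ∧ HStrip (lowerDiagram p) eta := by
  simp only [hStrip_iff_rowLen, rowLen_lowerDiagram, ← forall_and]
  intro i
  rcases lt_or_ge i r with h | h
  · have := extendZero_bounds p.2 h
    omega
  · simp [extendZero_of_le h, hmu (i + 1) (by omega), heta (i + 1) (by omega)]

theorem hStrip_upperDiagram
    (hmu : ∀ i, r ≤ i → mu.rowLen i = 0)
    (heta : ∀ i, r ≤ i → eta.rowLen i = 0)
    (q : ℕ × interlacing mu eta r) :
    HStrip mu (upperDiagram q) ∧ HStrip eta (upperDiagram q) := by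
  simp only [hStrip_iff_rowLen, rowLen_upperDiagram_succ, ← forall_and]
  intro i
  have hle : extendZero q.2.1 i ≤ mu.rowLen i ∧ extendZero q.2.1 i ≤ eta.rowLen i := by
    rcases lt_or_ge i r with h | h
    · exact (extendZero_bounds q.2.2 h).2.2
    · simp [extendZero_of_le h]
  refine ⟨⟨?_, hle.1⟩, ?_, hle.2⟩
  all_goals
    rcases i with _ | i
    · rw [rowLen_upperDiagram_zero]
      omega
    · rw [rowLen_upperDiagram_succ]
      rcases lt_or_ge i r with h | h
      · have := extendZero_bounds q.2.2 h
        omega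
      · simp [hmu (i + 1) (by omega), heta (i + 1) (by omega)]

theorem mem_range_lowerDiagram
    (hmu : ∀ i, r ≤ i → mu.rowLen i = 0)
    {kap : YoungDiagram} (h1 : HStrip kap mu) (h2 : HStrip kap eta) :
    kap ∈ Set.range (lowerDiagram (mu := mu) (eta := eta) (r := r)) := by
  rw [hStrip_iff_rowLen] at h1 h2
  refine ⟨⟨fun i => kap.rowLen i, ?_⟩, eq_of_rowLen_eq fun i => ?_⟩
  · refine Fintype.mem_piFinset.2 fun i => Finset.mem_Icc.2 ?_
    have := h1 i
    have := h2 i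
    omega
  · rw [rowLen_lowerDiagram, extendZero]
    split_ifs with h
    · rfl
    · have := h1 i
      have := hmu i (by omega)
      omega

theorem mem_range_upperDiagram
    (hmu : ∀ i, r ≤ i → mu.rowLen i = 0)
    {lam : YoungDiagram} (h1 : HStrip mu lam) (h2 : HStrip eta lam) :
    lam ∈ Set.range (upperDiagram (mu := mu) (eta := eta) (r := r)) := by
  rw [hStrip_iff_rowLen] at h1 h2
  refine ⟨(lam.rowLen 0 - max (mu.rowLen 0) (eta.rowLen 0), ⟨fun i => lam.rowLen (i + 1), ?_⟩),
    eq_of_rowLen_eq fun i => ?_⟩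
  · refine Fintype.mem_piFinset.2 fun i => Finset.mem_Icc.2 ?_
    have := h1 i
    have := h2 i
    have := h1 (i + 1)
    have := h2 (i + 1)
    omega
  · rcases i with _ | i
    · rw [rowLen_upperDiagram_zero]
      have := h1 0
      have := h2 0
      dsimp only
      omega
    · rw [rowLen_upperDiagram_succ, extendZero]
      split_ifs with h
      · rfl
      · have := h1 i
        have := hmu i (by omega)
        omega

end Interlacing

/-! ### Matrix entries as products over rows -/

section Evaluation

variable {σ R : Type*} [CommRing R]

theorem CoeffFinite.shift_one {b : ℤ → MvPowerSeries σ R} (hb : CoeffFinite b) :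
    CoeffFinite (fun i => b (i + 1)) :=
  hb.comp_injective (add_left_injective 1)

variable [TopologicalSpace R]

theorem edgeTail_shift (y : MvPowerSeries σ R) (b : ℤ → MvPowerSeries σ R) (t : ℤ) :
    edgeTail y (fun i => b (i + 1)) t = edgeTail y b (t + 1) := by
  rw [edgeTail, edgeTail]
  refine tprod_congr fun j => ?_
  ring_nf

variable [DiscreteTopology R] {mu eta : YoungDiagram} {r : ℕ}

theorem schurStep_eq {A : Type*} [CommRing A] (x : A) (b : ℤ → A) {mu lam : YoungDiagram}
    (h : HStrip mu lam) (hr : ∀ i, r ≤ i → lam.rowLen i = 0) :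
    schurStep x b mu lam = ∏ i ∈ Finset.range r, rowSchur x b i (mu.rowLen i) (lam.rowLen i) := by
  rw [schurStep, if_pos h, prod_sdiff_cells hr]
  rfl

theorem edgeStep_eq {a : ℤ → MvPowerSeries σ R} (ha : CoeffFinite a) (y : MvPowerSeries σ R)
    {mu lam : YoungDiagram} (h : HStrip mu lam) {s : ℕ} (hs : ∀ i, s ≤ i → lam.rowLen i = 0)
    (hr : ∀ i, r ≤ i → mu.rowLen i = 0) :
    edgeStep y a mu lam = (∏ i ∈ Finset.range s, y ^ (lam.rowLen i - mu.rowLen i)) *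
      (edgeTail y a (lam.rowLen 0) *
        ∏ i ∈ Finset.range r, rowEdge y a (i + 1) (lam.rowLen (i + 1)) (mu.rowLen i)) := by
  rw [edgeStep, if_pos h, prod_sdiff_cells hs, tprod_isLabelEdge ha y hr]
  simp [rowEdge]

theorem rowEdge_shift {A : Type*} [CommRing A] (y : A) (b : ℤ → A) (i p q : ℕ) :
    rowEdge y (fun k => b (k + 1)) (i + 1) p q = rowEdge y b i p q := by
  rw [rowEdge, rowEdge]
  refine Finset.prod_congr rfl fun j _ => ?_
  push_cast
  ring_nf

theorem schurStep_mul_edgeStep_lowerDiagram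
    (hmu : ∀ i, r ≤ i → mu.rowLen i = 0)
    (heta : ∀ i, r ≤ i → eta.rowLen i = 0)
    {b : ℤ → MvPowerSeries σ R} (hb : CoeffFinite b)
    (x y : MvPowerSeries σ R) (p : interlacing mu eta r) :
    schurStep x b (lowerDiagram p) eta * edgeStep y b (lowerDiagram p) mu
      = edgeTail y b (mu.rowLen 0) * ∏ i : Fin r,
          (rowSchur x b i (p.1 i) (eta.rowLen i) * y ^ (mu.rowLen i - p.1 i) *
            rowEdge y b (i + 1) (mu.rowLen (i + 1)) (p.1 i)) := by
  obtain ⟨h1, h2⟩ := hStrip_lowerDiagram hmu heta p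
  rw [schurStep_eq x b h2 heta, edgeStep_eq hb y h1 hmu (r := r)]
  · simp only [Finset.prod_range, rowLen_lowerDiagram, extendZero, Fin.is_lt, dite_true,
      Finset.prod_mul_distrib]
    ring
  · intro i hi
    rw [rowLen_lowerDiagram, extendZero_of_le hi]

theorem schurStep_mul_edgeStep_upperDiagram
    (hmu : ∀ i, r ≤ i → mu.rowLen i = 0)
    (heta : ∀ i, r ≤ i → eta.rowLen i = 0)
    {b : ℤ → MvPowerSeries σ R} (hb : CoeffFinite b)
    (x y : MvPowerSeries σ R) (q : ℕ × interlacing mu eta r) :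
    schurStep x b mu (upperDiagram q) * edgeStep y (fun i => b (i + 1)) eta (upperDiagram q)
      = rowSchur x b 0 (mu.rowLen 0) (eta.rowLen 0) * y ^ (mu.rowLen 0 - eta.rowLen 0) *
        ((∏ j ∈ Finset.Ico (max (mu.rowLen 0) (eta.rowLen 0))
            (max (mu.rowLen 0) (eta.rowLen 0) + q.1), y * (x + b j)) *
          edgeTail y b (max (mu.rowLen 0) (eta.rowLen 0) + q.1 + 1 : ℕ)) *
        ∏ i : Fin r, (rowSchur x b (i + 1) (mu.rowLen (i + 1)) (q.2.1 i) *
          y ^ (q.2.1 i - eta.rowLen (i + 1)) * rowEdge y b i (q.2.1 i) (eta.rowLen i)) := by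
  obtain ⟨h1, h2⟩ := hStrip_upperDiagram hmu heta q
  have hup : ∀ i, r + 1 ≤ i → (upperDiagram q).rowLen i = 0 := by
    intro i hi
    obtain ⟨i, rfl⟩ := Nat.exists_eq_succ_of_ne_zero (by omega : i ≠ 0)
    rw [Nat.succ_eq_add_one, rowLen_upperDiagram_succ, extendZero_of_le (by omega)]
  rw [schurStep_eq x b h1 hup, edgeStep_eq hb.shift_one y h2 hup heta,
    Finset.prod_range_succ', Finset.prod_range_succ']
  simp only [rowEdge_shift, edgeTail_shift, rowLen_upperDiagram_succ, rowLen_upperDiagram_zero,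
    Finset.prod_range, extendZero, Fin.is_lt, dite_true, Finset.prod_mul_distrib]
  have e1 : rowSchur x b 0 (mu.rowLen 0) (max (mu.rowLen 0) (eta.rowLen 0) + q.1)
      = rowSchur x b 0 (mu.rowLen 0) (eta.rowLen 0) *
        ∏ j ∈ Finset.Ico (max (mu.rowLen 0) (eta.rowLen 0))
            (max (mu.rowLen 0) (eta.rowLen 0) + q.1), (x + b j) := by
    rw [rowSchur, prod_Ico_of_max_le _ (Nat.le_add_right _ q.1), rowSchur]
    simp
  have e2 : max (mu.rowLen 0) (eta.rowLen 0) + q.1 - eta.rowLen 0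
      = (mu.rowLen 0 - eta.rowLen 0) + q.1 := by omega
  rw [e1, e2, pow_add, Finset.prod_const, Nat.card_Ico, Nat.add_sub_cancel_left]
  push_cast
  ring

end Evaluation

/-! ### The identity for one pair of variables -/

section Commutation

/-- The rows of an interlacing sequence vary independently, so this is distributivity. -/
theorem sum_interlacing {A : Type*} [CommRing A] (mu eta : YoungDiagram) {r : ℕ}
    (g : ℕ → ℕ → A) :
    ∑ p : interlacing mu eta r, ∏ i : Fin r, g i (p.1 i)
      = ∏ i ∈ Finset.range r, ∑ s ∈ Finset.Icc (max (mu.rowLen (i + 1)) (eta.rowLen (i + 1)))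
          (min (mu.rowLen i) (eta.rowLen i)), g i s := by
  rw [Finset.sum_coe_sort (interlacing mu eta r) fun p => ∏ i : Fin r, g i (p i), interlacing,
    Finset.prod_range, Finset.prod_univ_sum]

/-- The factor of the sums over interlacing diagrams which comes from the boxes that are in just
one of the rows `i` of `mu` and `eta`. -/
def boxFactor {A : Type*} [CommRing A] (x y : A) (b : ℤ → A) (mu eta : YoungDiagram) (i : ℕ) : A :=
  rowSchur x b i (mu.rowLen i) (eta.rowLen i) * y ^ (mu.rowLen i - eta.rowLen i)

/-- The factor of the sums over interlacing diagrams which comes from the edges below the row `i`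
of `eta` and outside `mu`. -/
def edgeFactor {A : Type*} [CommRing A] (y : A) (b : ℤ → A) (mu eta : YoungDiagram) (i : ℕ) : A :=
  rowEdge y b i (mu.rowLen i) (eta.rowLen i)

/-- The factor of the sums over interlacing diagrams which comes from the positions between the
rows `i + 1` and `i`. -/
def coreFactor {A : Type*} [CommRing A] (x y : A) (b : ℤ → A) (mu eta : YoungDiagram) (i : ℕ) : A :=
  rowCore x y b i (max (mu.rowLen (i + 1)) (eta.rowLen (i + 1))) (min (mu.rowLen i) (eta.rowLen i))

variable {σ R : Type*} [CommRing R] [TopologicalSpace R] [DiscreteTopology R]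
  {mu eta : YoungDiagram} {r : ℕ}

theorem sum_schurStep_mul_edgeStep_lower (hmu : ∀ i, r ≤ i → mu.rowLen i = 0)
    (heta : ∀ i, r ≤ i → eta.rowLen i = 0) {b : ℤ → MvPowerSeries σ R} (hb : CoeffFinite b)
    (x y : MvPowerSeries σ R) :
    ∑ kap ∈ Finset.Iic eta, schurStep x b kap eta * edgeStep y b kap mu
      = edgeTail y b (mu.rowLen 0) * ∏ i ∈ Finset.range r,
          (boxFactor x y b mu eta i * edgeFactor y b mu eta (i + 1) *
            coreFactor x y b mu eta i) := by
  have h1 : HasSum (fun kap => schurStep x b kap eta * edgeStep y b kap mu)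
      (∑ kap ∈ Finset.Iic eta, schurStep x b kap eta * edgeStep y b kap mu) := by
    refine hasSum_sum_of_ne_finset_zero fun kap hkap => ?_
    rw [triangular_schurStep _ _ _ _ (by simpa using hkap), zero_mul]
  rw [← (lowerDiagram_injective (mu := mu) (eta := eta) (r := r)).hasSum_iff] at h1
  · refine h1.unique ?_
    rw [Function.comp_def,
      funext fun p => schurStep_mul_edgeStep_lowerDiagram hmu heta hb x y p]
    refine HasSum.mul_left _ ?_
    have h2 := sum_interlacing mu eta (r := r) fun i s =>
      rowSchur x b i s (eta.rowLen i) * y ^ (mu.rowLen i - s) *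
        rowEdge y b (i + 1) (mu.rowLen (i + 1)) s
    simp only [sum_row_lower] at h2
    unfold boxFactor edgeFactor coreFactor
    rw [← h2]
    exact hasSum_fintype _
  · intro kap hkap
    by_contra h0
    refine hkap (mem_range_lowerDiagram hmu ?_ ?_)
    · by_contra h
      exact h0 (by rw [edgeStep, if_neg h, mul_zero])
    · by_contra h
      exact h0 (by rw [schurStep, if_neg h, zero_mul])

theorem hasSum_schurStep_mul_edgeStep_upper (hmu : ∀ i, r ≤ i → mu.rowLen i = 0)
    (heta : ∀ i, r ≤ i → eta.rowLen i = 0) {b : ℤ → MvPowerSeries σ R} (hb : CoeffFinite b)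
    (x : MvPowerSeries σ R) {y : MvPowerSeries σ R} (hy : y.constantCoeff = 0) :
    HasSum (fun lam => schurStep x b mu lam * edgeStep y (fun i => b (i + 1)) eta lam)
      (boxFactor x y b mu eta 0 * (MvPowerSeries.invOfUnit (1 - x * y) 1 *
          edgeTail y b (max (mu.rowLen 0) (eta.rowLen 0) : ℕ)) *
        ∏ i ∈ Finset.range r, (boxFactor x y b mu eta (i + 1) * edgeFactor y b mu eta i *
          coreFactor x y b mu eta i)) := by
  have hs := (((graded_edgeStep hy fun i => b (i + 1)).coeffFinite_mul eta
    (schurStep x b mu)).comp_injective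
      (upperDiagram_injective (mu := mu) (eta := eta) (r := r))).summable
  rw [← (upperDiagram_injective (mu := mu) (eta := eta) (r := r)).hasSum_iff]
  · rw [funext fun q => schurStep_mul_edgeStep_upperDiagram hmu heta hb x y q] at hs
    rw [Function.comp_def, funext fun q => schurStep_mul_edgeStep_upperDiagram hmu heta hb x y q]
    have h1 := (hasSum_geometric_edgeTail hb x hy (max (mu.rowLen 0) (eta.rowLen 0))).mul_left
      (rowSchur x b 0 (mu.rowLen 0) (eta.rowLen 0) * y ^ (mu.rowLen 0 - eta.rowLen 0))
    have h2 := sum_interlacing mu eta (r := r) fun i s =>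
      rowSchur x b (i + 1) (mu.rowLen (i + 1)) s * y ^ (s - eta.rowLen (i + 1)) *
        rowEdge y b i s (eta.rowLen i)
    simp only [sum_row_upper] at h2
    unfold boxFactor edgeFactor coreFactor
    rw [← h2]
    have h3 := hasSum_fintype fun p : interlacing mu eta r => ∏ i : Fin r,
      (rowSchur x b (i + 1) (mu.rowLen (i + 1)) (p.1 i) * y ^ (p.1 i - eta.rowLen (i + 1)) *
        rowEdge y b i (p.1 i) (eta.rowLen i))
    have h4 := h1.mul h3 hs
    exact h4
  · intro lam hlam
    by_contra h0
    refine hlam (mem_range_upperDiagram hmu ?_ ?_)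
    · by_contra h
      exact h0 (by rw [schurStep, if_neg h, zero_mul])
    · by_contra h
      exact h0 (by rw [edgeStep, if_neg h, mul_zero])

theorem prod_range_shift {A : Type*} [CommRing A] {f : ℕ → A} {r : ℕ} (hf : f r = 1) :
    (∏ i ∈ Finset.range r, f (i + 1)) * f 0 = ∏ i ∈ Finset.range r, f i := by
  rw [← Finset.prod_range_succ', Finset.prod_range_succ, hf, mul_one]

/-- The skew Cauchy identity for a single pair of variables. -/
theorem skewCommute_schurStep_edgeStep {b : ℤ → MvPowerSeries σ R} (hb : CoeffFinite b)
    (x : MvPowerSeries σ R) {y : MvPowerSeries σ R} (hy : y.constantCoeff = 0) :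
    DiagramMatrix.SkewCommute (schurStep x b) (edgeStep y fun i => b (i + 1)) (edgeStep y b)
      (MvPowerSeries.invOfUnit (1 - x * y) 1) := by
  intro mu eta
  obtain ⟨r, hmu, heta⟩ : ∃ r, (∀ i, r ≤ i → mu.rowLen i = 0) ∧
      ∀ i, r ≤ i → eta.rowLen i = 0 :=
    ⟨max mu.card eta.card, fun i hi => rowLen_eq_zero_of_card_le ((le_max_left _ _).trans hi),
      fun i hi => rowLen_eq_zero_of_card_le ((le_max_right _ _).trans hi)⟩
  have hD : boxFactor x y b mu eta r = 1 := by
    simp [boxFactor, hmu r le_rfl, heta r le_rfl, rowSchur_self]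
  have hE : edgeFactor y b mu eta r = 1 := by
    simp [edgeFactor, hmu r le_rfl, heta r le_rfl, rowEdge_self]
  have htail : edgeTail y b (mu.rowLen 0)
      = edgeFactor y b mu eta 0 * edgeTail y b (max (mu.rowLen 0) (eta.rowLen 0) : ℕ) := by
    rw [edgeTail_eq_prod_Ico_mul hb y (le_max_left (mu.rowLen 0) (eta.rowLen 0)),
      prod_Ico_of_max_le _ le_rfl]
    simp [edgeFactor, rowEdge]
  rw [sum_schurStep_mul_edgeStep_lower hmu heta hb]
  convert hasSum_schurStep_mul_edgeStep_upper hmu heta hb x hy using 1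
  simp only [Finset.prod_mul_distrib]
  -- The box factors are indexed from `0` below and from `1` above, the edge factors the other way
  -- round. The missing box factor `0` is explicit above; the missing edge factor `0` is the
  -- discrepancy between the two tails.
  rw [htail, ← prod_range_shift hD, ← prod_range_shift hE]
  ring

end Commutation

/-! ### Semistandard tableaux as chains of diagrams -/

section Levels

variable {n : ℕ} {lam mu : YoungDiagram}

theorem mem_skewBox {b : ℕ × ℕ} : b ∈ lam.cells \ mu.cells ↔ b ∈ lam ∧ b ∉ mu := by simp

theorem IsSemistandard.monotone {T : SkewBox lam mu → Fin n} (hT : IsSemistandard T)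
    {b c : SkewBox lam mu} (h : b.1 ≤ c.1) : T b ≤ T c := by
  obtain ⟨⟨i, j⟩, hb⟩ := b
  obtain ⟨⟨i', j'⟩, hc⟩ := c
  obtain ⟨hi, hj⟩ : i ≤ i' ∧ j ≤ j' := h
  have hb' := mem_skewBox.1 hb
  have hc' := mem_skewBox.1 hc
  -- The corner in the row of `b` and the column of `c`: above `c`, hence in `lam`, and to the right
  -- of `b`, hence outside `mu`.
  have hd : (i, j') ∈ lam.cells \ mu.cells :=
    mem_skewBox.2 ⟨lam.up_left_mem hi le_rfl hc'.1,
      fun h => hb'.2 (mu.up_left_mem le_rfl hj h)⟩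
  refine (hT.1 ⟨_, hb⟩ ⟨_, hd⟩ rfl hj).trans ?_
  rcases hi.lt_or_eq with h | rfl
  · exact (hT.2 ⟨_, hd⟩ ⟨_, hc⟩ rfl h).le
  · exact le_rfl

/-- The diagram formed by the boxes of `mu` and the boxes of `lam / mu` with an entry less
than `l`. -/
def level {T : SkewBox lam mu → Fin n} (hT : IsSemistandard T) (l : ℕ) : YoungDiagram where
  cells := lam.cells.filter fun b => ∀ h : b ∈ lam.cells \ mu.cells, (T ⟨b, h⟩ : ℕ) < l
  isLowerSet := by
    intro b c hcb hb
    simp only [Finset.coe_filter, YoungDiagram.mem_cells, Set.mem_ofPred_eq] at hb ⊢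
    have hc : c ∈ lam := lam.isLowerSet hcb hb.1
    refine ⟨hc, fun h => ?_⟩
    have hb' : b ∈ lam.cells \ mu.cells :=
      mem_skewBox.2 ⟨hb.1, fun h' => (mem_skewBox.1 h).2 (mu.isLowerSet hcb h')⟩
    exact lt_of_le_of_lt (hT.monotone (b := ⟨c, h⟩) (c := ⟨b, hb'⟩) hcb) (hb.2 hb')

variable {T : SkewBox lam mu → Fin n} (hT : IsSemistandard T)

theorem mem_level {l : ℕ} {b : ℕ × ℕ} :
    b ∈ level hT l ↔ b ∈ lam ∧ ∀ h : b ∈ lam.cells \ mu.cells, (T ⟨b, h⟩ : ℕ) < l := by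
  change b ∈ lam.cells.filter _ ↔ _
  simp

theorem level_le (l : ℕ) : level hT l ≤ lam := fun _ hb => ((mem_level hT).1 hb).1

theorem le_level (h : mu ≤ lam) (l : ℕ) : mu ≤ level hT l :=
  fun _ hb => (mem_level hT).2 ⟨h hb, fun h' => absurd hb (mem_skewBox.1 h').2⟩

theorem level_top : level hT n = lam :=
  le_antisymm (level_le hT n) fun _ hb => (mem_level hT).2 ⟨hb, fun _ => Fin.is_lt _⟩

theorem hStrip_level (l : ℕ) : HStrip (level hT l) (level hT (l + 1)) := by
  refine ⟨fun b hb => ?_, fun i j hb => ?_⟩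
  · rw [mem_level] at hb ⊢
    exact ⟨hb.1, fun h => (hb.2 h).trans (Nat.lt_succ_self l)⟩
  · rw [mem_level] at hb ⊢
    refine ⟨lam.up_left_mem (Nat.le_succ i) le_rfl hb.1, fun h => ?_⟩
    have h' : (i + 1, j) ∈ lam.cells \ mu.cells :=
      mem_skewBox.2 ⟨hb.1, fun h' =>
        (mem_skewBox.1 h).2 (mu.up_left_mem (Nat.le_succ i) le_rfl h')⟩
    have h1 : T ⟨_, h⟩ < T ⟨_, h'⟩ := hT.2 _ _ rfl (Nat.lt_succ_self i)
    have h2 := hb.2 h'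
    have h3 : (T ⟨_, h⟩ : ℕ) < T ⟨_, h'⟩ := h1
    omega

theorem mem_level_succ_sdiff_level {l : ℕ} {b : ℕ × ℕ} :
    b ∈ (level hT (l + 1)).cells \ (level hT l).cells ↔
      ∃ h : b ∈ lam.cells \ mu.cells, (T ⟨b, h⟩ : ℕ) = l := by
  rw [mem_skewBox, mem_level, mem_level]
  constructor
  · rintro ⟨⟨h1, h2⟩, h3⟩
    have h4 : ∃ h : b ∈ lam.cells \ mu.cells, ¬ (T ⟨b, h⟩ : ℕ) < l := by
      by_contra! h
      exact h3 ⟨h1, h⟩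
    obtain ⟨h, h5⟩ := h4
    exact ⟨h, by have := h2 h; omega⟩
  · rintro ⟨h, h1⟩
    refine ⟨⟨(mem_skewBox.1 h).1, fun _ => by omega⟩, fun h2 => ?_⟩
    have := h2.2 h
    omega

theorem prod_level {A : Type*} [CommRing A] (f : Fin n → ℕ × ℕ → A) :
    ∏ b, f (T b) b.1
      = ∏ i : Fin n, ∏ b ∈ (level hT (i + 1)).cells \ (level hT i).cells, f i b := by
  classical
  rw [← Finset.prod_fiberwise Finset.univ T]
  refine Finset.prod_congr rfl fun i _ => ?_
  refine Finset.prod_bij (fun b _ => b.1) ?_ ?_ ?_ ?_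
  · intro b hb
    rw [Finset.mem_filter] at hb
    exact (mem_level_succ_sdiff_level hT).2 ⟨b.2, congrArg Fin.val hb.2⟩
  · intro b _ c _ h
    exact Subtype.ext h
  · intro b hb
    obtain ⟨h, h'⟩ := (mem_level_succ_sdiff_level hT).1 hb
    exact ⟨⟨b, h⟩, Finset.mem_filter.2 ⟨Finset.mem_univ _, Fin.ext h'⟩, rfl⟩
  · intro b hb
    rw [(Finset.mem_filter.1 hb).2]

end Levels

/-! ### Tableau sums as matrix products -/

section Chains

variable {m : ℕ} {lam nu mu : YoungDiagram}

open Classical in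
/-- Fill the boxes outside `nu` with the largest letter. -/
def extendFilling (lam : YoungDiagram) (T : SkewBox nu mu → Fin m) (b : SkewBox lam mu) :
    Fin (m + 1) :=
  if h : b.1 ∈ nu then (T ⟨b.1, mem_skewBox.2 ⟨h, (mem_skewBox.1 b.2).2⟩⟩).castSucc else Fin.last m

theorem isSemistandard_extendFilling {T : SkewBox nu mu → Fin m} (hT : IsSemistandard T)
    (h : HStrip nu lam) : IsSemistandard (extendFilling lam T) := by
  constructor
  · intro b c hr hc
    by_cases hcn : c.1 ∈ nu
    · have hbn : b.1 ∈ nu := nu.isLowerSet (Prod.mk_le_mk.2 ⟨hr.le, hc⟩) hcn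
      simp only [extendFilling, hcn, hbn, dite_true, Fin.castSucc_le_castSucc_iff]
      exact hT.1 _ _ hr hc
    · simp only [extendFilling, hcn, dite_false]
      exact Fin.le_last _
  · intro b c hc hr
    have hcl := (mem_skewBox.1 c.2).1
    have hbn : b.1 ∈ nu := h.2 _ _ (lam.isLowerSet (Prod.mk_le_mk.2 ⟨hr, hc.le⟩) hcl)
    by_cases hcn : c.1 ∈ nu
    · simp only [extendFilling, hcn, hbn, dite_true, Fin.castSucc_lt_castSucc_iff]
      exact hT.2 _ _ hc hr
    · simp only [extendFilling, hcn, hbn, dite_true, dite_false]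
      exact Fin.castSucc_lt_last _

theorem level_extendFilling {T : SkewBox nu mu → Fin m} (hT : IsSemistandard T)
    (h : HStrip nu lam) (hmu : mu ≤ nu) {l : ℕ} (hl : l ≤ m) :
    level (isSemistandard_extendFilling hT h) l = level hT l := by
  refine le_antisymm (fun b hb => ?_) fun b hb => ?_
  · rw [mem_level] at hb ⊢
    have hbn : b ∈ nu := by
      by_contra hbn
      have hb' : b ∈ lam.cells \ mu.cells := mem_skewBox.2 ⟨hb.1, fun h => hbn (hmu h)⟩
      have := hb.2 hb'
      simp only [extendFilling, hbn, dite_false, Fin.val_last] at this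
      omega
    refine ⟨hbn, fun hb' => ?_⟩
    have := hb.2 (mem_skewBox.2 ⟨hb.1, (mem_skewBox.1 hb').2⟩)
    simpa [extendFilling, hbn] using this
  · rw [mem_level] at hb ⊢
    refine ⟨h.1 hb.1, fun hb' => ?_⟩
    have := hb.2 (mem_skewBox.2 ⟨hb.1, (mem_skewBox.1 hb').2⟩)
    simpa [extendFilling, hb.1] using this

theorem exists_extendFilling_eq {T : SkewBox lam mu → Fin (m + 1)} (hT : IsSemistandard T) :
    ∃ T' : SkewBox (level hT m) mu → Fin m, IsSemistandard T' ∧ extendFilling lam T' = T := by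
  have hmem : ∀ b : SkewBox (level hT m) mu, b.1 ∈ lam.cells \ mu.cells := fun b =>
    mem_skewBox.2 ⟨level_le hT m (mem_skewBox.1 b.2).1, (mem_skewBox.1 b.2).2⟩
  refine ⟨fun b => ⟨T ⟨b.1, hmem b⟩, ((mem_level hT).1 (mem_skewBox.1 b.2).1).2 (hmem b)⟩,
    ⟨fun b c hr hc => hT.1 ⟨b.1, hmem b⟩ ⟨c.1, hmem c⟩ hr hc,
      fun b c hc hr => hT.2 ⟨b.1, hmem b⟩ ⟨c.1, hmem c⟩ hc hr⟩, ?_⟩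
  funext b
  rw [extendFilling]
  split_ifs with h
  · rfl
  · refine le_antisymm ?_ (Fin.le_last _)
    by_contra hlt
    refine h ((mem_level hT).2 ⟨(mem_skewBox.1 b.2).1, fun h' => ?_⟩)
    exact Fin.lt_def.1 (not_le.1 hlt)

open Classical in
/-- The generating function of semistandard tableaux, when the weight is a product over the
letters, is an entry of a product of matrices. -/
theorem sum_semistandard_eq_chain {A : Type*} [CommRing A] : ∀ {m : ℕ} {lam mu : YoungDiagram}
    (W : Fin m → DiagramMatrix A), (∀ i nu lam, ¬ HStrip nu lam → W i nu lam = 0) → mu ≤ lam →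
    ∑ T : {T : SkewBox lam mu → Fin m // IsSemistandard T},
      ∏ i : Fin m, W i (level T.2 i) (level T.2 (i + 1)) = DiagramMatrix.chain W mu lam
  | 0, lam, mu, W, _, hle => by
    rw [DiagramMatrix.chain, DiagramMatrix.id]
    split_ifs with h
    · subst h
      have : IsEmpty (SkewBox mu mu) := ⟨fun b => by simpa using b.2⟩
      have : Unique {T : SkewBox mu mu → Fin 0 // IsSemistandard T} :=
        { default := ⟨isEmptyElim, fun b => isEmptyElim b, fun b => isEmptyElim b⟩
          uniq := fun T => Subtype.ext (Subsingleton.elim _ _) }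
      simp
    · have : IsEmpty {T : SkewBox lam mu → Fin 0 // IsSemistandard T} := by
        refine ⟨fun T => ?_⟩
        obtain ⟨b, hb, hb'⟩ := SetLike.exists_of_lt (lt_of_le_of_ne hle h)
        exact (T.1 ⟨b, mem_skewBox.2 ⟨hb, hb'⟩⟩).elim0
      simp
  | m + 1, lam, mu, W, hW, hle => by
    rw [DiagramMatrix.chain, DiagramMatrix.comp]
    -- Group the tableaux by the diagram `nu` left after removing the largest letter. The fibre over
    -- `nu` consists of the tableaux of shape `nu / mu`, extended by that letter.
    rw [← Finset.sum_fiberwise_of_maps_to (s := Finset.univ) (t := Finset.Iic lam)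
      (g := fun T : {T : SkewBox lam mu → Fin (m + 1) // IsSemistandard T} => level T.2 m)
      (fun T _ => Finset.mem_Iic.2 (level_le T.2 m))]
    refine Finset.sum_congr rfl fun nu _ => ?_
    have hfib : ∀ T ∈ Finset.univ.filter
        (fun T : {T : SkewBox lam mu → Fin (m + 1) // IsSemistandard T} => level T.2 m = nu),
        ∏ i : Fin (m + 1), W i (level T.2 i) (level T.2 (i + 1))
          = (∏ i : Fin m, W i.castSucc (level T.2 i) (level T.2 (i + 1))) * W (Fin.last m) nu lam := by
      intro T hT
      rw [Fin.prod_univ_castSucc]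
      simp only [Fin.val_castSucc, Fin.val_last, level_top, (Finset.mem_filter.1 hT).2]
    rw [Finset.sum_congr rfl hfib, ← Finset.sum_mul]
    by_cases hs : HStrip nu lam
    · congr 1
      have htri : ∀ i : Fin m, (W i.castSucc).Triangular :=
        fun i nu lam h => hW _ _ _ fun h' => h h'.1
      by_cases hmn : mu ≤ nu
      · rw [← sum_semistandard_eq_chain (fun i : Fin m => W i.castSucc)
          (fun i => hW i.castSucc) hmn]
        symm
        refine Finset.sum_bij
          (fun T _ => ⟨extendFilling lam T.1, isSemistandard_extendFilling T.2 hs⟩) ?_ ?_ ?_ ?_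
        · intro T _
          rw [Finset.mem_filter]
          exact ⟨Finset.mem_univ _, by rw [level_extendFilling T.2 hs hmn le_rfl, level_top]⟩
        · intro T _ T' _ h
          refine Subtype.ext (funext fun b => ?_)
          have hb := mem_skewBox.1 b.2
          have := congrFun (congrArg Subtype.val h) ⟨b.1, mem_skewBox.2 ⟨hs.1 hb.1, hb.2⟩⟩
          simpa [extendFilling, hb.1] using this
        · rintro ⟨T, hT⟩ hTn
          obtain rfl := (Finset.mem_filter.1 hTn).2
          obtain ⟨T', hT', h⟩ := exists_extendFilling_eq hT
          exact ⟨⟨T', hT'⟩, Finset.mem_univ _, Subtype.ext h⟩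
        · intro T _
          refine Finset.prod_congr rfl fun i _ => ?_
          rw [level_extendFilling T.2 hs hmn (by omega), level_extendFilling T.2 hs hmn (by omega)]
      · rw [DiagramMatrix.triangular_chain htri _ _ hmn, Finset.filter_false_of_mem,
          Finset.sum_empty]
        rintro T _ rfl
        exact hmn (le_level T.2 hle m)
    · rw [hW _ _ _ hs, mul_zero, mul_zero]

/-- The element `i : Fin n` stands for the letter `i + 1`, so its parameter `a (i + 1 + c)` is
`shift i a c`. -/
theorem factorialSchur_neg_eq_chain {A : Type*} [CommRing A] {n : ℕ} (lam mu : YoungDiagram)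
    (x : Fin n → A) (a : ℤ → A) :
    factorialSchur lam mu x (-a)
      = DiagramMatrix.chain (fun i : Fin n => schurStep (x i) (shift i a)) mu lam := by
  rw [factorialSchur]
  split_ifs with h
  · rw [← sum_semistandard_eq_chain (fun i : Fin n => schurStep (x i) (shift i a))
      (fun i nu lam h => if_neg h) h]
    refine Finset.sum_congr rfl fun T _ => ?_
    have := prod_level T.2 fun i b => x i - (-a) ((i : ℕ) + 1 + content b)
    rw [this]
    refine Finset.prod_congr rfl fun i _ => ?_
    rw [schurStep, if_pos (hStrip_level T.2 i)]
    refine Finset.prod_congr rfl fun b _ => ?_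
    rw [Pi.neg_apply, sub_neg_eq_add, shift]
    ring_nf
  · rw [DiagramMatrix.triangular_chain (fun i => triangular_schurStep _ _) _ _ h]

end Chains

/-! ### Edge labels sorted by letter -/

section Labels

variable {m : ℕ} {lam mu : YoungDiagram}

/-- An edge is determined by its row and content, and the row of a label edge is at most `lam.card`.
-/
theorem finite_isLabelEdge_content (lam mu : YoungDiagram) {F : Set ℤ} (hF : F.Finite) :
    {e : ℕ × ℕ | IsLabelEdge lam mu e ∧ content e ∈ F}.Finite := by
  refine Set.Finite.of_finite_image (f := fun e => (e.1, content e))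
    (((Set.finite_Iic lam.card).prod hF).subset ?_) ?_
  · rintro _ ⟨⟨i, j⟩, ⟨he, hc⟩, rfl⟩
    refine ⟨?_, hc⟩
    rcases i with _ | i
    · exact Nat.zero_le _
    · exact fst_lt_card (he.2 i (Nat.lt_succ_self i))
  · rintro ⟨i, j⟩ _ ⟨i', j'⟩ _ h
    simp only [Prod.mk.injEq, content] at h ⊢
    omega

/-- This decouples the letters: whether `l` may label an edge depends only on the two levels around
`l`. The comparison with the nearest box above suffices because entries increase down a column. -/
theorem forall_label_iff_isLabelEdge_level {T : SkewBox lam mu → Fin m} (hT : IsSemistandard T)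
    (hle : mu ≤ lam) (e : ℕ × ℕ) (l : Fin m) :
    (IsLabelEdge lam mu e ∧ (∀ b : SkewBox lam mu, b.1 = e → l < T b) ∧
      ∀ b : SkewBox lam mu, (b.1.1 + 1, b.1.2) = e → T b < l) ↔
    IsLabelEdge (level hT l) (level hT (l + 1)) e := by
  constructor
  · rintro ⟨⟨h1, h2⟩, h3, h4⟩
    refine ⟨fun h => ?_, fun i hi => ?_⟩
    · rw [mem_level] at h
      have he : e ∈ lam.cells \ mu.cells := mem_skewBox.2 ⟨h.1, h1⟩
      have h5 := h.2 he
      have h6 : (l : ℕ) < T ⟨e, he⟩ := h3 ⟨e, he⟩ rfl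
      omega
    · rw [mem_level]
      refine ⟨h2 i hi, fun h => ?_⟩
      obtain ⟨k, j⟩ := e
      dsimp only at hi h h2 ⊢
      obtain ⟨k, rfl⟩ := Nat.exists_eq_succ_of_ne_zero (by omega : k ≠ 0)
      have hk : (k, j) ∈ lam.cells \ mu.cells :=
        mem_skewBox.2 ⟨h2 k (Nat.lt_succ_self k), fun h' =>
          (mem_skewBox.1 h).2 (mu.up_left_mem (Nat.lt_succ_iff.1 hi) le_rfl h')⟩
      have h5 : T ⟨(i, j), h⟩ ≤ T ⟨(k, j), hk⟩ :=
        hT.monotone (Prod.mk_le_mk.2 ⟨Nat.lt_succ_iff.1 hi, le_rfl⟩)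
      exact lt_of_le_of_lt h5 (h4 ⟨(k, j), hk⟩ rfl)
  · rintro ⟨h1, h2⟩
    refine ⟨⟨fun h => h1 (le_level hT hle _ h), fun i hi => level_le hT _ (h2 i hi)⟩, ?_, ?_⟩
    · rintro ⟨b, hb⟩ rfl
      by_contra h
      refine h1 ((mem_level hT).2 ⟨(mem_skewBox.1 hb).1, fun _ => ?_⟩)
      exact Nat.lt_succ_of_le (not_lt.1 h)
    · rintro ⟨b, hb⟩ rfl
      exact ((mem_level hT).1 (h2 b.1 (Nat.lt_succ_self _))).2 hb

/-- The labels on edges that are compatible with a semistandard tableau. -/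
def admissibleLabels {T : SkewBox lam mu → Fin m} (hT : IsSemistandard T) :
    Set ((ℕ × ℕ) × Fin m) :=
  {p | IsLabelEdge (level hT p.2) (level hT (p.2 + 1)) p.1}

open Classical in
/-- An edge labeled tableau is a semistandard tableau with a finite set of admissible labels. -/
def edgeTableauEquiv (hle : mu ≤ lam) : EdgeTableau m lam mu ≃
    Σ T : {T : SkewBox lam mu → Fin m // IsSemistandard T}, Finset (admissibleLabels T.2) where
  toFun T := ⟨⟨T.entry, T.semistandard⟩, T.labels.subtype (· ∈ admissibleLabels T.semistandard)⟩
  invFun q :=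
    have h : ∀ p ∈ q.2.map (Function.Embedding.subtype _), _ := fun p hp =>
      (forall_label_iff_isLabelEdge_level q.1.2 hle p.1 p.2).2
        (Finset.property_of_mem_map_subtype q.2 hp)
    { entry := q.1.1
      labels := q.2.map (Function.Embedding.subtype _)
      semistandard := q.1.2
      isLabelEdge := fun p hp => (h p hp).1
      label_lt := fun p hp => (h p hp).2.1
      lt_label := fun p hp => (h p hp).2.2 }
  left_inv T := by
    have : (T.labels.subtype (· ∈ admissibleLabels T.semistandard)).map
        (Function.Embedding.subtype _) = T.labels := by
      rw [Finset.subtype_map, Finset.filter_true_of_mem]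
      intro p hp
      exact (forall_label_iff_isLabelEdge_level T.semistandard hle p.1 p.2).1
        ⟨T.isLabelEdge p hp, T.label_lt p hp, T.lt_label p hp⟩
    cases T
    simp only [EdgeTableau.mk.injEq, true_and]
    exact this
  right_inv q := by
    obtain ⟨⟨T, hT⟩, L⟩ := q
    simp only [Sigma.mk.injEq, true_and, heq_eq_eq]
    ext p
    simp

theorem EdgeTableau.ext_entry_labels {S T : EdgeTableau m lam mu} (h : S.entry = T.entry)
    (h' : S.labels = T.labels) : S = T := by
  cases S
  cases T
  simp_all

end Labels

/-! ### Edge Schur functions as matrix entries -/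

section Series

variable {σ R : Type*} [CommRing R] {m : ℕ}

theorem CoeffFinite.comp_snd {ι κ : Type*} [Finite κ] {f : ι → MvPowerSeries σ R}
    (hf : CoeffFinite f) : CoeffFinite (fun q : κ × ι => f q.2) := by
  intro d
  refine (Set.finite_univ.prod (hf d)).subset fun q hq => ⟨Set.mem_univ _, hq⟩

theorem coeffFinite_label {a : ℤ → MvPowerSeries σ R} (ha : CoeffFinite a)
    (y : Fin m → MvPowerSeries σ R) (lam mu : YoungDiagram) :
    CoeffFinite fun p : {p : (ℕ × ℕ) × Fin m | IsLabelEdge lam mu p.1} =>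
      y p.1.2 * a (content p.1.1) := by
  have h : CoeffFinite fun p : {p : (ℕ × ℕ) × Fin m | IsLabelEdge lam mu p.1} =>
      a (content p.1.1) := by
    intro d
    refine Set.Finite.of_finite_image (f := Subtype.val)
      (((finite_isLabelEdge_content lam mu (ha d)).prod (Set.finite_univ (α := Fin m))).subset ?_)
      Subtype.val_injective.injOn
    rintro _ ⟨p, hp, rfl⟩
    exact ⟨⟨p.2, hp⟩, Set.mem_univ _⟩
  exact h.mul_left fun p => y p.1.2

-- A tableau is determined by its filling, of which there are finitely many, and its finite set of
-- labels, so `CoeffFinite.finset_prod` applies.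
open Classical in
theorem coeffFinite_weight {a : ℤ → MvPowerSeries σ R} (ha : CoeffFinite a)
    (y : Fin m → MvPowerSeries σ R) (lam mu : YoungDiagram) :
    CoeffFinite fun T : EdgeTableau m lam mu => T.weight y a := by
  have h := ((coeffFinite_label ha y lam mu).finset_prod.comp_snd
    (κ := SkewBox lam mu → Fin m)).mul_left fun q => ∏ b, y (q.1 b)
  have hmap : ∀ T : EdgeTableau m lam mu,
      (T.labels.subtype (· ∈ {p : (ℕ × ℕ) × Fin m | IsLabelEdge lam mu p.1})).map
        (Function.Embedding.subtype _) = T.labels := fun T => by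
    rw [Finset.subtype_map, Finset.filter_true_of_mem]
    exact T.isLabelEdge
  have h' := h.comp_injective (g := fun T : EdgeTableau m lam mu =>
    (T.entry, T.labels.subtype (· ∈ {p : (ℕ × ℕ) × Fin m | IsLabelEdge lam mu p.1}))) ?_
  · convert h' using 2 with T
    rw [EdgeTableau.weight]
    congr 1
    conv_lhs => rw [← hmap T, Finset.prod_map]
    rfl
  · intro S T hST
    rw [Prod.mk.injEq] at hST
    refine EdgeTableau.ext_entry_labels hST.1 ?_
    rw [← hmap S, ← hmap T, hST.2]

variable {lam mu : YoungDiagram}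

theorem coeffFinite_admissibleLabels {a : ℤ → MvPowerSeries σ R} (ha : CoeffFinite a)
    (y : Fin m → MvPowerSeries σ R) {T : SkewBox lam mu → Fin m} (hT : IsSemistandard T)
    (hle : mu ≤ lam) :
    CoeffFinite fun p : admissibleLabels hT => y p.1.2 * a (content p.1.1) :=
  (coeffFinite_label ha y lam mu).comp_injective
    (g := fun p : admissibleLabels hT =>
      ⟨p.1, ((forall_label_iff_isLabelEdge_level hT hle p.1.1 p.1.2).2 p.2).1⟩)
    fun p q h => by simpa [Subtype.ext_iff] using h

/-- Admissible labels, sorted by the letter. -/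
def admissibleLabelsEquiv {T : SkewBox lam mu → Fin m} (hT : IsSemistandard T) :
    (Σ l : Fin m, {e : ℕ × ℕ | IsLabelEdge (level hT l) (level hT (l + 1)) e}) ≃
      admissibleLabels hT where
  toFun q := ⟨(q.2.1, q.1), q.2.2⟩
  invFun p := ⟨p.1.2, p.1.1, p.2⟩
  left_inv _ := rfl
  right_inv _ := rfl

variable [TopologicalSpace R] [DiscreteTopology R]

theorem tprod_admissibleLabels {a : ℤ → MvPowerSeries σ R} (ha : CoeffFinite a)
    (y : Fin m → MvPowerSeries σ R) {T : SkewBox lam mu → Fin m} (hT : IsSemistandard T)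
    (hle : mu ≤ lam) :
    ∏' p : admissibleLabels hT, (1 + y p.1.2 * a (content p.1.1))
      = ∏ l : Fin m, ∏' e : {e : ℕ × ℕ | IsLabelEdge (level hT l) (level hT (l + 1)) e},
          (1 + y l * a (content e)) := by
  have h := (coeffFinite_admissibleLabels ha y hT hle).comp_injective
    (admissibleLabelsEquiv hT).injective
  rw [← (admissibleLabelsEquiv hT).tprod_eq]
  have h1 := h.multipliable_one_add
  rw [Multipliable.tprod_sigma' (fun l => ?_) h1, tprod_fintype]
  · rfl
  · exact (h.comp_injective (sigma_mk_injective (i := l))).multipliable_one_add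

theorem weight_edgeTableauEquiv_symm {A : Type*} [CommRing A] (y : Fin m → A) (a : ℤ → A)
    (hle : mu ≤ lam) (q : Σ T : {T : SkewBox lam mu → Fin m // IsSemistandard T},
      Finset (admissibleLabels T.2)) :
    ((edgeTableauEquiv hle).symm q).weight y a
      = (∏ b, y (q.1.1 b)) * ∏ p ∈ q.2, y p.1.2 * a (content p.1.1) := by
  rw [EdgeTableau.weight]
  congr 1
  exact Finset.prod_map q.2 (Function.Embedding.subtype _)
    fun p : (ℕ × ℕ) × Fin m => y p.2 * a (content p.1)

/-- Labels are chosen independently, so the sum over finite label sets is the expansion of a product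
of factors `1 + y a`, which is then sorted by letter. -/
theorem tsum_finset_admissibleLabels {a : ℤ → MvPowerSeries σ R} (ha : CoeffFinite a)
    (y : Fin m → MvPowerSeries σ R) {T : SkewBox lam mu → Fin m} (hT : IsSemistandard T)
    (hle : mu ≤ lam) :
    ∑' L : Finset (admissibleLabels hT), (∏ b, y (T b)) * ∏ p ∈ L, y p.1.2 * a (content p.1.1)
      = ∏ i : Fin m, edgeStep (y i) a (level hT i) (level hT (i + 1)) := by
  have hlab := coeffFinite_admissibleLabels ha y hT hle
  rw [hlab.finset_prod.summable.tsum_mul_left,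
    ← tprod_one_add hlab.finset_prod.summable, tprod_admissibleLabels ha y hT hle,
    prod_level hT fun i _ => y i, ← Finset.prod_mul_distrib]
  refine Finset.prod_congr rfl fun i _ => ?_
  rw [edgeStep, if_pos (hStrip_level hT i)]

theorem edgeSchur_eq_chain {a : ℤ → MvPowerSeries σ R} (ha : CoeffFinite a)
    (y : Fin m → MvPowerSeries σ R) (lam mu : YoungDiagram) :
    edgeSchur lam mu y a
      = DiagramMatrix.chain (fun j : Fin m => edgeStep (y j) a) mu lam := by
  classical
  rw [edgeSchur]
  split_ifs with hle
  · have h := (coeffFinite_weight ha y lam mu).comp_injective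
      (edgeTableauEquiv hle).symm.injective
    rw [← (edgeTableauEquiv hle).symm.tsum_eq]
    simp only [weight_edgeTableauEquiv_symm] at h ⊢
    have hfib := fun T : {T : SkewBox lam mu → Fin m // IsSemistandard T} =>
      (h.comp_injective (sigma_mk_injective (i := T))).summable
    rw [h.summable.tsum_sigma' hfib, tsum_fintype,
      ← sum_semistandard_eq_chain (fun j : Fin m => edgeStep (y j) a)
        (fun i nu lam h => if_neg h) hle]
    exact Finset.sum_congr rfl fun T _ => tsum_finset_admissibleLabels ha y T.2 hle
  · rw [DiagramMatrix.triangular_chain (fun i => triangular_edgeStep _ _) _ _ hle]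

end Series

/-! ### Assembly for all variables -/

section Main

theorem coeffFinite_paramA (n m : ℕ) (R : Type*) [CommRing R] (N : WithTop ℤ) :
    CoeffFinite (paramA n m R N) := by
  classical
  intro d
  refine (d.support.finite_toSet.preimage
    ((Sum.inr_injective.comp Sum.inr_injective).injOn)).subset fun k hk => ?_
  simp only [paramA, Set.mem_ofPred_eq] at hk
  split_ifs at hk with h
  · rw [MvPowerSeries.coeff_X] at hk
    have : d = Finsupp.single (Sum.inr (Sum.inr k)) 1 := by
      by_contra h'
      exact hk (if_neg h')
    simp [this]
  · simp at hk

theorem CoeffFinite.shift {σ R : Type*} [CommRing R] {a : ℤ → MvPowerSeries σ R}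
    (ha : CoeffFinite a) (k : ℕ) : CoeffFinite (shift k a) :=
  ha.comp_injective (g := fun i : ℤ => i + k + 1) fun i j h => by simpa using h

theorem shift_succ {A : Type*} (k : ℕ) (a : ℤ → A) :
    shift (k + 1) a = fun i => shift k a (i + 1) := by
  funext i
  simp only [shift]
  push_cast
  ring_nf

variable {σ R : Type*} [CommRing R] [TopologicalSpace R] [DiscreteTopology R] {n m : ℕ}

theorem skewCommute_chain {a : ℤ → MvPowerSeries σ R} (ha : CoeffFinite a)
    (x : Fin n → MvPowerSeries σ R) {y : Fin m → MvPowerSeries σ R}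
    (hy : ∀ j, (y j).constantCoeff = 0) :
    DiagramMatrix.SkewCommute (DiagramMatrix.chain fun i : Fin n => schurStep (x i) (shift i a))
      (DiagramMatrix.chain fun j : Fin m => edgeStep (y j) (shift n a))
      (DiagramMatrix.chain fun j : Fin m => edgeStep (y j) (shift 0 a))
      (∏ i : Fin n, ∏ j : Fin m, MvPowerSeries.invOfUnit (1 - x i * y j) 1) := by
  refine DiagramMatrix.skewCommute_chain_left
    (V := fun k => DiagramMatrix.chain fun j : Fin m => edgeStep (y j) (shift k a))
    (fun k => DiagramMatrix.graded_chain fun j => graded_edgeStep (hy j) _)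
    (fun i => triangular_schurStep _ _) fun i => ?_
  refine DiagramMatrix.skewCommute_chain_right (triangular_schurStep _ _)
    (fun j => triangular_edgeStep _ _) (fun j => triangular_edgeStep _ _)
    (fun j => graded_edgeStep (hy j) _) fun j => ?_
  rw [shift_succ]
  exact skewCommute_schurStep_edgeStep (ha.shift i) (x i) (hy j)

end Main

end SkewCauchy

end

/-- The skew Cauchy identity for factorial Schur polynomials and edge Schur functions.
The first conjunct says that the series defining the edge Schur functions converge, the next
two that the two sums of the identity converge. The coefficient ring is discrete. -/
theorem mainTheorem2 (R : Type*) [CommRing R] [TopologicalSpace R] [DiscreteTopology R]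
    (n m : ℕ) (N : WithTop ℤ) (mu eta : YoungDiagram) :
    (∀ (k : ℕ) (lam nu : YoungDiagram), Summable fun T : SkewCauchy.EdgeTableau m lam nu =>
      T.weight (SkewCauchy.varY n m R) (SkewCauchy.shift k (SkewCauchy.paramA n m R N))) ∧
    (Summable fun lam : YoungDiagram =>
      SkewCauchy.factorialSchur lam mu (SkewCauchy.varX n m R) (-SkewCauchy.paramA n m R N) *
        SkewCauchy.edgeSchur lam eta (SkewCauchy.varY n m R)
          (SkewCauchy.shift n (SkewCauchy.paramA n m R N))) ∧
    (Summable fun kap : YoungDiagram =>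
      SkewCauchy.factorialSchur eta kap (SkewCauchy.varX n m R) (-SkewCauchy.paramA n m R N) *
        SkewCauchy.edgeSchur mu kap (SkewCauchy.varY n m R)
          (SkewCauchy.shift 0 (SkewCauchy.paramA n m R N))) ∧
    ∑' lam : YoungDiagram,
      SkewCauchy.factorialSchur lam mu (SkewCauchy.varX n m R) (-SkewCauchy.paramA n m R N) *
        SkewCauchy.edgeSchur lam eta (SkewCauchy.varY n m R)
          (SkewCauchy.shift n (SkewCauchy.paramA n m R N)) =
    (∏ i : Fin n, ∏ j : Fin m,
      MvPowerSeries.invOfUnit (1 - SkewCauchy.varX n m R i * SkewCauchy.varY n m R j) 1) *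
    ∑' kap : YoungDiagram,
      SkewCauchy.factorialSchur eta kap (SkewCauchy.varX n m R) (-SkewCauchy.paramA n m R N) *
        SkewCauchy.edgeSchur mu kap (SkewCauchy.varY n m R)
          (SkewCauchy.shift 0 (SkewCauchy.paramA n m R N)) := by
  have ha := SkewCauchy.coeffFinite_paramA n m R N
  have hmain := SkewCauchy.skewCommute_chain ha (SkewCauchy.varX n m R)
    (y := SkewCauchy.varY n m R) (fun j => by simp [SkewCauchy.varY]) mu eta
  simp only [← SkewCauchy.factorialSchur_neg_eq_chain,
    ← SkewCauchy.edgeSchur_eq_chain (ha.shift _)] at hmain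
  -- The right-hand series has finite support: the Schur factor vanishes unless `kap ≤ eta`.
  have hfin : HasSum (fun kap : YoungDiagram =>
      SkewCauchy.factorialSchur eta kap (SkewCauchy.varX n m R) (-SkewCauchy.paramA n m R N) *
        SkewCauchy.edgeSchur mu kap (SkewCauchy.varY n m R)
          (SkewCauchy.shift 0 (SkewCauchy.paramA n m R N))) _ :=
    hasSum_sum_of_ne_finset_zero (s := Finset.Iic eta) fun kap hkap => by
      rw [SkewCauchy.factorialSchur, if_neg (by simpa using hkap), zero_mul]
  refine ⟨fun k lam nu => (SkewCauchy.coeffFinite_weight (ha.shift k) _ lam nu).summable,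
    hmain.summable, hfin.summable, ?_⟩
  rw [hmain.tsum_eq, hfin.tsum_eq]
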